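/- Let $V$ be a finite set, $H$ a Hermitian matrix on $\mathbb C^V$ with spectral projections $P_E$, $(A^a)_a$ a finite family of matrices closed under adjoints, $\beta>0$ an inverse temperature and $\sigma_E>0$ an energy resolution. Put $$f(t)=e^{-\sigma_E^2t^2}\sqrt{\sigma_E\sqrt{2/\pi}},\qquad \hat f(\omega)=\frac{1}{\sqrt{\sigma_E\sqrt{2\pi}}}\,e^{-\omega^2/(4\sigma_E^2)},\qquad \gamma(\omega)=\exp\!\Big(-\beta\max\big(\omega+\tfrac{\beta\sigma_E^2}{2},0\big)\Big),$$ $$\hat A^a(\omega)=\frac1{\sqrt{2\pi}}\int_{-\infty}^\infty e^{iHt}A^ae^{-iHt}e^{-i\omega t}f(t)\,dt,\qquad A^a_\nu=\sum_{E'-E=\nu}P_{E'}A^aP_E,$$ $$\theta(\nu_1,\nu_2)=\int_{-\infty}^\infty\hat f(\omega-\nu_1)\hat f(\omega-\nu_2)\gamma(\omega)\,d\omega,\qquad B=\sum_a\sum_{\nu_1,\nu_2}\frac{\tanh(-\beta(\nu_1-\nu_2)/4)}{2i}\,\theta(\nu_1,\nu_2)\,(A^a_{\nu_2})^\dagger A^a_{\nu_1},$$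 where $\nu_1,\nu_2$ range over the differences of eigenvalues of $H$. The CKG (Chen–Kastoryano–Gilyén) Lindbladian is the superoperator $$\mathcal L_\beta[X]=-i[B,X]+\sum_a\int_{-\infty}^\infty\gamma(\omega)\Big(\hat A^a(\omega)X\hat A^a(\omega)^\dagger-\tfrac12\{\hat A^a(\omega)^\dagger\hat A^a(\omega),X\}\Big)d\omega .$$ Its spectral gap is $\min_{j>1}|\lambda_j|$, where $\lambda_1=0,\lambda_2,\lambda_3,\dots$ are its eigenvalues listed with multiplicity. **Theorem.** For every fixed $\beta>0$ there exists a constant $\sigma_E>0$, independent of $n$, such that, for $H$ the adjacency matrix of the cyclic graph on $n$ vertices and the graph-local jump operators $A^a=n^{-1/2}|e_a\rangle\langle e_a|$, $a=1,\dots,n$, the spectral gap of the CKG Lindbladian $\mathcal L_\beta$ is $\Theta(n^{-3})$ as $n\to\infty$. -/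

import Mathlib

open Filter Asymptotics MeasureTheory
open scoped Matrix

noncomputable section

namespace CKG

variable {V : Type*} [Fintype V] [DecidableEq V]

/-! ### Scalar functions -/

/-- The Gaussian time window `f(t) = exp(-σ² t²) √(σ √(2/π))` of energy resolution `σ`. -/
def window (σ t : ℝ) : ℝ :=
  Real.exp (-σ ^ 2 * t ^ 2) * √(σ * √(2 / Real.pi))

/-- Its (unitary) Fourier transform `f̂(ω) = (σ √(2π))^{-1/2} exp(-ω² / (4σ²))`. -/
def windowHat (σ ω : ℝ) : ℝ :=
  1 / √(σ * √(2 * Real.pi)) * Real.exp (-ω ^ 2 / (4 * σ ^ 2))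

/-- The shifted Metropolis filter `γ(ω) = exp(-β max(ω + β σ² / 2, 0))`. -/
def filter (β σ ω : ℝ) : ℝ :=
  Real.exp (-β * max (ω + β * σ ^ 2 / 2) 0)

/-- `θ(ν₁, ν₂) = ∫ f̂(ω - ν₁) f̂(ω - ν₂) γ(ω) dω`. -/
def theta (β σ ν₁ ν₂ : ℝ) : ℝ :=
  ∫ ω : ℝ, windowHat σ (ω - ν₁) * windowHat σ (ω - ν₂) * filter β σ ω

/-! ### Bohr frequencies of a Hamiltonian -/

/-- The finite set of energies (real eigenvalues) of `H`. -/
def energies (H : Matrix V V ℂ) : Finset ℝ :=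
  (Matrix.finite_real_spectrum (A := H)).toFinset

/-- The spectral projection of the Hermitian matrix `H` at the energy `E`, i.e. the indicator
function of `{E}` applied to `H`; it is `0` if `E` is not an energy. -/
def energyProj (H : Matrix V V ℂ) (E : ℝ) : Matrix V V ℂ :=
  cfc (Set.indicator {E} (fun _ : ℝ => (1 : ℝ))) H

/-- The Bohr frequencies: all differences of energies. -/
def bohrFreqs (H : Matrix V V ℂ) : Finset ℝ :=
  Finset.image₂ (fun E E' => E - E') (energies H) (energies H)

/-- The component `A_ν` of `A` that raises the energy by exactly `ν`:
`A_ν = ∑_{E' - E = ν} P_{E'} A P_E`. -/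
def bohrComponent (H A : Matrix V V ℂ) (ν : ℝ) : Matrix V V ℂ :=
  ∑ E ∈ energies H, energyProj H (E + ν) * A * energyProj H E

/-! ### The CKG Lindbladian -/

/-- The Gaussian operator Fourier transform
`Â(ω) = (2π)^{-1/2} ∫ e^{iHt} A e^{-iHt} e^{-iωt} f(t) dt`, the integral being taken entrywise. -/
def operatorFT (σ : ℝ) (H A : Matrix V V ℂ) (ω : ℝ) : Matrix V V ℂ :=
  Matrix.of fun i j =>
    ((1 / √(2 * Real.pi) : ℝ) : ℂ) *
      ∫ t : ℝ,
        (NormedSpace.exp ((Complex.I * t) • H) * A * NormedSpace.exp ((-(Complex.I * t)) • H)) i j *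
          Complex.exp (-(Complex.I * ω * t)) * (window σ t : ℂ)

/-- The dissipator `X ↦ K X K† - (1/2) (K† K X + X K† K)` of a Lindblad operator `K`. -/
def dissipator (K : Matrix V V ℂ) : Module.End ℂ (Matrix V V ℂ) :=
  LinearMap.mulLeft ℂ K ∘ₗ LinearMap.mulRight ℂ Kᴴ -
    (1 / 2 : ℂ) • (LinearMap.mulLeft ℂ (Kᴴ * K) + LinearMap.mulRight ℂ (Kᴴ * K))

/-- The commutator superoperator `X ↦ B X - X B`. -/
def commutator (B : Matrix V V ℂ) : Module.End ℂ (Matrix V V ℂ) :=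
  LinearMap.mulLeft ℂ B - LinearMap.mulRight ℂ B

/-- The integral over `ω ∈ ℝ` of a superoperator-valued function, taken coefficientwise: it is the
superoperator whose value on the matrix unit `|k⟩⟨l|` has `(i, j)` entry
`∫ (F ω |k⟩⟨l|)_{ij} dω`. -/
def superIntegral (F : ℝ → Module.End ℂ (Matrix V V ℂ)) : Module.End ℂ (Matrix V V ℂ) :=
  (Matrix.stdBasis ℂ V V).constr ℂ fun p =>
    Matrix.of fun i j => ∫ ω : ℝ, F ω (Matrix.single p.1 p.2 1) i j

/-- The coherent term
`B = ∑_a ∑_{ν₁, ν₂} (tanh(-β (ν₁ - ν₂) / 4) / (2i)) θ(ν₁, ν₂) (A^a_{ν₂})† A^a_{ν₁}`. -/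
def coherentTerm {ι : Type*} [Fintype ι] (β σ : ℝ) (H : Matrix V V ℂ) (A : ι → Matrix V V ℂ) :
    Matrix V V ℂ :=
  ∑ a, ∑ ν₁ ∈ bohrFreqs H, ∑ ν₂ ∈ bohrFreqs H,
    ((Real.tanh (-β * (ν₁ - ν₂) / 4) * theta β σ ν₁ ν₂ : ℝ) / (2 * Complex.I) : ℂ) •
      ((bohrComponent H (A a) ν₂)ᴴ * bohrComponent H (A a) ν₁)

/-- The CKG Lindbladian with inverse temperature `β`, energy resolution `σ`, Hamiltonian `H` and
jump operators `A a`: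
`L[X] = -i [B, X] + ∑_a ∫ γ(ω) (Â^a(ω) X Â^a(ω)† - (1/2) {Â^a(ω)† Â^a(ω), X}) dω`. -/
def lindbladian {ι : Type*} [Fintype ι] (β σ : ℝ) (H : Matrix V V ℂ) (A : ι → Matrix V V ℂ) :
    Module.End ℂ (Matrix V V ℂ) :=
  (-Complex.I) • commutator (coherentTerm β σ H A) +
    ∑ a, superIntegral fun ω => (filter β σ ω : ℂ) • dissipator (operatorFT σ H (A a) ω)

/-- The spectral gap `min_{j > 1} |λ_j|`, where `λ_1 = 0, λ_2, λ_3, …` are the eigenvalues of `L`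
listed with algebraic multiplicity: one copy of the eigenvalue `0` (the one belonging to the Gibbs
state) is discarded. In particular the gap is `0` if `0` is a multiple eigenvalue. -/
def spectralGap (L : Module.End ℂ (Matrix V V ℂ)) : ℝ :=
  sInf {r : ℝ | ∃ z ∈ L.charpoly.roots.erase 0, r = ‖z‖}

/-! ### The cyclic graph with graph-local jumps -/

/-- The Hamiltonian of the cyclic graph on `n` vertices: its adjacency matrix. -/
def cycleHamiltonian (n : ℕ) : Matrix (Fin n) (Fin n) ℂ :=
  (SimpleGraph.cycleGraph n).adjMatrix ℂ

/-- The graph-local jump operators `A^a = n^{-1/2} |e_a⟩⟨e_a|`. -/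
def localJump (n : ℕ) (a : Fin n) : Matrix (Fin n) (Fin n) ℂ :=
  ((1 / √(n : ℝ) : ℝ) : ℂ) • Matrix.single a a 1

end CKG

end

/-!
In the Fourier basis the cycle Hamiltonian is diagonal, with energies `2 cos (2πk / n)`, and the
correlations `∑_a A^a_{ij} (A^a_{kl})*` of the local jumps are translation invariant: they equal
`n⁻²` if `i - j = k - l` and vanish otherwise. Hence the coherent term vanishes and the Lindbladian
leaves the spans of the matrix units `|k + q⟩⟨k|` with fixed `q` invariant, acting on each as a
real matrix with nonnegative off-diagonal entries. Its column sums are `-1/2` times sums of defects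
`θ(a, a) + θ(b, b) - 2 θ(a, b)`, which are comparable to `(a - b)²` for bounded `a` and `b`. With
the strength `n⁻²` of the jumps, these sums are at least of order `n⁻³` for every `q ≠ 0`, and
exactly of this order for `q = 1`.

Lower bound: in the sectors `q ≠ 0` Gershgorin's theorem gives `Re λ ≤ -c / n³`. The sector `q = 0`
is a classical Markov generator all of whose rates are at least `c / n²`; subtracting the matrix
with all entries `c / n²` keeps its eigenvalues, except for one copy of `0`, and shifts the column
sums to `-c / n`, so Gershgorin's theorem applies again.

Upper bound: by detailed balance the sector `q = 1` is similar to a symmetric matrix, and the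
Rayleigh quotient at the square root of the Gibbs weight is a weighted mean of the column sums.
-/

namespace CKG

/-! ### The correlation kernel -/

section Kernel

variable {β σ : ℝ}

theorem filter_pos (β σ ω : ℝ) : 0 < filter β σ ω := Real.exp_pos _

theorem filter_le_one (hβ : 0 ≤ β) (σ ω : ℝ) : filter β σ ω ≤ 1 := by
  rw [filter, Real.exp_le_one_iff, neg_mul, neg_nonpos]
  positivity

theorem antitone_filter (hβ : 0 ≤ β) (σ : ℝ) : Antitone (filter β σ) := fun x y h => by
  simp only [filter, neg_mul]
  gcongr

theorem continuous_filter (β σ : ℝ) : Continuous (filter β σ) := by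
  unfold filter
  fun_prop

theorem filter_neg_sub (β σ ω : ℝ) :
    filter β σ (-ω - β * σ ^ 2) = Real.exp (β * (ω + β * σ ^ 2 / 2)) * filter β σ ω := by
  have hneg : -ω - β * σ ^ 2 + β * σ ^ 2 / 2 = -(ω + β * σ ^ 2 / 2) := by ring
  rw [filter, filter, ← Real.exp_add, hneg]
  congr 1
  rcases le_total (ω + β * σ ^ 2 / 2) 0 with h | h
  · rw [max_eq_right h, max_eq_left (neg_nonneg.2 h)]
    ring
  · rw [max_eq_left h, max_eq_right (neg_nonpos.2 h)]
    ring

theorem windowHat_pos (hσ : 0 < σ) (ω : ℝ) : 0 < windowHat σ ω := by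
  have := Real.pi_pos
  unfold windowHat
  positivity

theorem windowHat_neg (σ ω : ℝ) : windowHat σ (-ω) = windowHat σ ω := by
  simp only [windowHat, neg_sq]

theorem windowHat_le_windowHat {x y : ℝ} (h : |x| ≤ y) : windowHat σ y ≤ windowHat σ x := by
  have hsq : x ^ 2 ≤ y ^ 2 := sq_le_sq' (abs_le.1 h).1 (abs_le.1 h).2
  unfold windowHat
  gcongr

theorem windowHat_mul (hσ : 0 < σ) (a b ω : ℝ) :
    windowHat σ (ω - a) * windowHat σ (ω - b) =
      1 / (σ * √(2 * Real.pi)) * Real.exp (-(a - b) ^ 2 / (8 * σ ^ 2)) *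
        Real.exp (-(1 / (2 * σ ^ 2)) * (ω - (a + b) / 2) ^ 2) := by
  have h : √(σ * √(2 * Real.pi)) * √(σ * √(2 * Real.pi)) = σ * √(2 * Real.pi) :=
    Real.mul_self_sqrt (by positivity)
  rw [windowHat, windowHat, mul_mul_mul_comm, div_mul_div_comm, h, one_mul, ← Real.exp_add,
    mul_assoc, ← Real.exp_add]
  congr 2
  field_simp
  ring

theorem windowHat_sub_ge {R x y : ℝ} (hx : 1 ≤ x) (hxy : x ≤ y) (hy : y ≤ R) :
    windowHat σ R / (2 * σ ^ 2) * (y - x) ≤ windowHat σ x - windowHat σ y := by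
  have hfactor : windowHat σ x =
      windowHat σ y * Real.exp ((y ^ 2 - x ^ 2) / (4 * σ ^ 2)) := by
    rw [windowHat, windowHat, mul_assoc, ← Real.exp_add]
    ring_nf
  have hexp : (y - x) / (2 * σ ^ 2) ≤ Real.exp ((y ^ 2 - x ^ 2) / (4 * σ ^ 2)) - 1 := by
    refine le_trans ?_ (le_sub_iff_add_le.2 (Real.add_one_le_exp _))
    calc (y - x) / (2 * σ ^ 2) = 2 * (y - x) / (4 * σ ^ 2) := by ring
      _ ≤ (y ^ 2 - x ^ 2) / (4 * σ ^ 2) := by gcongr; nlinarith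
  have hR : windowHat σ R ≤ windowHat σ y :=
    windowHat_le_windowHat (abs_le.2 ⟨by linarith, hy⟩)
  have hy0 : 0 ≤ windowHat σ y := by unfold windowHat; positivity
  have : 0 ≤ (y - x) / (2 * σ ^ 2) := div_nonneg (sub_nonneg.2 hxy) (by positivity)
  calc windowHat σ R / (2 * σ ^ 2) * (y - x)
      = windowHat σ R * ((y - x) / (2 * σ ^ 2)) := by ring
    _ ≤ windowHat σ y * (Real.exp ((y ^ 2 - x ^ 2) / (4 * σ ^ 2)) - 1) := by gcongr
    _ = windowHat σ x - windowHat σ y := by rw [hfactor]; ring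

theorem integrable_windowHat_mul (hσ : 0 < σ) (a b : ℝ) :
    Integrable fun ω => windowHat σ (ω - a) * windowHat σ (ω - b) := by
  simp_rw [windowHat_mul hσ]
  exact ((integrable_exp_neg_mul_sq (b := 1 / (2 * σ ^ 2)) (by positivity)).comp_sub_right
    ((a + b) / 2)).const_mul _

theorem integrable_theta (hβ : 0 ≤ β) (hσ : 0 < σ) (a b : ℝ) :
    Integrable fun ω => windowHat σ (ω - a) * windowHat σ (ω - b) * filter β σ ω := by
  refine (integrable_windowHat_mul hσ a b).mul_bdd (c := 1)
    (continuous_filter β σ).aestronglyMeasurable (ae_of_all _ fun ω => ?_)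
  rw [Real.norm_of_nonneg (filter_pos β σ ω).le]
  exact filter_le_one hβ σ ω

theorem theta_nonneg (hσ : 0 < σ) (a b : ℝ) : 0 ≤ theta β σ a b :=
  integral_nonneg fun ω => mul_nonneg
    (mul_pos (windowHat_pos hσ _) (windowHat_pos hσ _)).le (filter_pos β σ ω).le

theorem theta_comm (β σ a b : ℝ) : theta β σ a b = theta β σ b a := by
  simp only [theta, mul_comm (windowHat σ (_ - a))]

theorem theta_zero_left (hσ : 0 < σ) (a b : ℝ) :
    theta 0 σ a b = Real.exp (-(a - b) ^ 2 / (8 * σ ^ 2)) := by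
  have hsqrt : √(Real.pi / (1 / (2 * σ ^ 2))) = σ * √(2 * Real.pi) := by
    rw [show Real.pi / (1 / (2 * σ ^ 2)) = σ ^ 2 * (2 * Real.pi) by field_simp,
      Real.sqrt_mul (by positivity), Real.sqrt_sq hσ.le]
  have : 0 < σ * √(2 * Real.pi) := by have := Real.pi_pos; positivity
  simp only [theta, filter, neg_zero, zero_mul, Real.exp_zero, mul_one, windowHat_mul hσ]
  rw [integral_const_mul,
    integral_sub_right_eq_self (fun ω => Real.exp (-(1 / (2 * σ ^ 2)) * ω ^ 2)),
    integral_gaussian, hsqrt]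
  field_simp

-- The reflection `ω ↦ -ω - β σ²` maps the Gaussian at `-(a + b) / 2` to the one at `(a + b) / 2`
-- tilted by `exp (-β ω)`, and the filter compensates for the tilt.
theorem theta_neg_neg (hσ : 0 < σ) (a b : ℝ) :
    theta β σ (-a) (-b) = Real.exp (β * (a + b) / 2) * theta β σ a b := by
  have hwindow : ∀ ω, windowHat σ (-ω - β * σ ^ 2 - -a) * windowHat σ (-ω - β * σ ^ 2 - -b) *
      Real.exp (β * (ω + β * σ ^ 2 / 2)) =
        Real.exp (β * (a + b) / 2) * (windowHat σ (ω - a) * windowHat σ (ω - b)) := by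
    intro ω
    have hexp : Real.exp (-(1 / (2 * σ ^ 2)) * (-ω - β * σ ^ 2 - (-a + -b) / 2) ^ 2) *
        Real.exp (β * (ω + β * σ ^ 2 / 2)) = Real.exp (β * (a + b) / 2) *
          Real.exp (-(1 / (2 * σ ^ 2)) * (ω - (a + b) / 2) ^ 2) := by
      rw [← Real.exp_add, ← Real.exp_add]
      congr 1
      field_simp
      ring
    rw [windowHat_mul hσ, windowHat_mul hσ, mul_assoc, hexp, ← neg_sub' a b, neg_sq]
    ring
  rw [theta, theta, ← integral_sub_left_eq_self _ volume (-(β * σ ^ 2)), ← integral_const_mul]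
  congr 1 with ω
  rw [neg_sub_comm (β * σ ^ 2) ω, filter_neg_sub, ← mul_assoc, hwindow]
  ring

theorem le_integral_of_le_on_Icc {f : ℝ → ℝ} {c x : ℝ} (hf : Integrable f) (h0 : ∀ ω, 0 ≤ f ω)
    (hc : ∀ ω ∈ Set.Icc x (x + 1), c ≤ f ω) : c ≤ ∫ ω, f ω :=
  calc c = ∫ _ in Set.Icc x (x + 1), c := by simp
    _ ≤ ∫ ω in Set.Icc x (x + 1), f ω :=
        setIntegral_mono_on (by simp) hf.integrableOn measurableSet_Icc hc
    _ ≤ ∫ ω, f ω := setIntegral_le_integral hf (ae_of_all _ h0)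

theorem exists_le_theta_self (hβ : 0 ≤ β) (hσ : 0 < σ) (R : ℝ) :
    ∃ c, 0 < c ∧ ∀ ν, |ν| ≤ R → c ≤ theta β σ ν ν := by
  have hw := windowHat_pos hσ (1 + R)
  refine ⟨windowHat σ (1 + R) * windowHat σ (1 + R) * filter β σ 1,
    mul_pos (mul_pos hw hw) (filter_pos _ _ _), fun ν hν => ?_⟩
  refine le_integral_of_le_on_Icc (x := 0) (integrable_theta hβ hσ ν ν)
    (fun ω => mul_nonneg (mul_self_nonneg _) (filter_pos β σ ω).le) fun ω hω => ?_
  obtain ⟨hω0, hω1⟩ : 0 ≤ ω ∧ ω ≤ 1 := by simpa using hω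
  have hle : windowHat σ (1 + R) ≤ windowHat σ (ω - ν) := by
    obtain ⟨h1, h2⟩ := abs_le.1 hν
    exact windowHat_le_windowHat (abs_le.2 ⟨by linarith, by linarith⟩)
  have hw' := windowHat_pos hσ (ω - ν)
  have hf := filter_pos β σ 1
  have hanti : filter β σ 1 ≤ filter β σ ω := antitone_filter hβ σ hω1
  gcongr

/-- The defect `θ(a, a) + θ(b, b) - 2 θ(a, b)` of a kernel: the squared distance between the
feature vectors of `a` and `b` when `θ` is positive semidefinite. -/
def defect (θ : ℝ → ℝ → ℝ) (a b : ℝ) : ℝ := θ a a + θ b b - 2 * θ a b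

theorem defect_const_mul (κ : ℝ) (θ : ℝ → ℝ → ℝ) (a b : ℝ) :
    defect (fun a b => κ * θ a b) a b = κ * defect θ a b := by
  simp only [defect]
  ring

theorem integrable_windowHat_sub_sq (hβ : 0 ≤ β) (hσ : 0 < σ) (a b : ℝ) :
    Integrable fun ω => (windowHat σ (ω - a) - windowHat σ (ω - b)) ^ 2 * filter β σ ω := by
  refine (((integrable_theta hβ hσ a a).add (integrable_theta hβ hσ b b)).sub
    ((integrable_theta hβ hσ a b).const_mul 2)).congr (ae_of_all _ fun ω => ?_)
  simp only [Pi.add_apply, Pi.sub_apply]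
  ring

theorem defect_theta (hβ : 0 ≤ β) (hσ : 0 < σ) (a b : ℝ) :
    defect (theta β σ) a b =
      ∫ ω, (windowHat σ (ω - a) - windowHat σ (ω - b)) ^ 2 * filter β σ ω := by
  have haa := integrable_theta hβ hσ a a
  have hbb := integrable_theta hβ hσ b b
  have hab := (integrable_theta hβ hσ a b).const_mul 2
  rw [defect, theta, theta, theta, ← integral_const_mul, ← integral_add haa hbb]
  refine (integral_sub (haa.add hbb) hab).symm.trans (integral_congr_ae (ae_of_all _ fun ω => ?_))
  simp only [Pi.add_apply]
  ring

theorem defect_theta_nonneg (hβ : 0 ≤ β) (hσ : 0 < σ) (a b : ℝ) : 0 ≤ defect (theta β σ) a b := by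
  rw [defect_theta hβ hσ]
  exact integral_nonneg fun ω => mul_nonneg (sq_nonneg _) (filter_pos β σ ω).le

theorem defect_theta_le (hβ : 0 ≤ β) (hσ : 0 < σ) (a b : ℝ) :
    defect (theta β σ) a b ≤ 1 / (4 * σ ^ 2) * (a - b) ^ 2 :=
  calc defect (theta β σ) a b ≤ defect (theta 0 σ) a b := by
        rw [defect_theta hβ hσ, defect_theta le_rfl hσ]
        refine integral_mono (integrable_windowHat_sub_sq hβ hσ a b)
          (integrable_windowHat_sub_sq le_rfl hσ a b) fun ω => ?_
        simp only [filter.eq_1 0, neg_zero, zero_mul, Real.exp_zero]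
        gcongr
        exact filter_le_one hβ σ ω
    _ = 2 * (1 - Real.exp (-(a - b) ^ 2 / (8 * σ ^ 2))) := by
        simp only [defect, theta_zero_left hσ, sub_self, ne_eq, OfNat.ofNat_ne_zero,
          not_false_eq_true, zero_pow, neg_zero, zero_div, Real.exp_zero]
        ring
    _ ≤ 2 * ((a - b) ^ 2 / (8 * σ ^ 2)) := by
        linarith [Real.add_one_le_exp (-(a - b) ^ 2 / (8 * σ ^ 2)),
          neg_div (8 * σ ^ 2) ((a - b) ^ 2)]
    _ = 1 / (4 * σ ^ 2) * (a - b) ^ 2 := by ring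

theorem exists_le_defect_theta (hβ : 0 ≤ β) (hσ : 0 < σ) (R : ℝ) :
    ∃ c, 0 < c ∧ ∀ a b, |a| ≤ R → |b| ≤ R → c * (a - b) ^ 2 ≤ defect (theta β σ) a b := by
  set w := windowHat σ (2 * R + 2) / (2 * σ ^ 2)
  have hw : 0 < w := div_pos (windowHat_pos hσ _) (by positivity)
  have hfilter := filter_pos β σ (R + 2)
  refine ⟨w ^ 2 * filter β σ (R + 2), by positivity, fun a b ha hb => ?_⟩
  wlog hab : a ≤ b generalizing a b
  · have h := this b a hb ha (le_of_not_ge hab)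
    rw [defect, theta_comm β σ b a] at h
    rw [defect]
    linarith [sub_sq_comm a b]
  rw [defect_theta hβ hσ]
  refine le_integral_of_le_on_Icc (x := R + 1) (integrable_windowHat_sub_sq hβ hσ a b)
    (fun ω => mul_nonneg (sq_nonneg _) (filter_pos β σ ω).le) fun ω ⟨hω, hω'⟩ => ?_
  obtain ⟨ha1, -⟩ := abs_le.1 ha
  obtain ⟨-, hb2⟩ := abs_le.1 hb
  have hsub : w * (b - a) ≤ windowHat σ (ω - b) - windowHat σ (ω - a) := by
    have h := windowHat_sub_ge (σ := σ) (R := 2 * R + 2) (x := ω - b) (y := ω - a)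
      (by linarith) (by linarith) (by linarith)
    rwa [sub_sub_sub_cancel_left] at h
  have hanti : filter β σ (R + 2) ≤ filter β σ ω := antitone_filter hβ σ (by linarith)
  have : 0 ≤ w * (b - a) := mul_nonneg hw.le (by linarith)
  calc w ^ 2 * filter β σ (R + 2) * (a - b) ^ 2
      = (w * (b - a)) ^ 2 * filter β σ (R + 2) := by ring
    _ ≤ (windowHat σ (ω - b) - windowHat σ (ω - a)) ^ 2 * filter β σ ω := by gcongr
    _ = (windowHat σ (ω - a) - windowHat σ (ω - b)) ^ 2 * filter β σ ω := by
        rw [sub_sq_comm]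

end Kernel

/-! ### Eigenvalues of rate matrices and the spectral gap -/

section Charpoly

open Polynomial

variable {I J R : Type*} [Fintype I] [DecidableEq I] [Fintype J] [DecidableEq J] [CommRing R]

theorem charpoly_blockDiagonal (M : J → Matrix I I R) :
    (Matrix.blockDiagonal M).charpoly = ∏ j, (M j).charpoly := by
  simp only [Matrix.charpoly, ← Matrix.det_blockDiagonal]
  congr 1
  ext ⟨i, j⟩ ⟨i', j'⟩
  by_cases hj : j = j' <;> by_cases hi : i = i' <;>
    simp [Matrix.blockDiagonal_apply, hi, hj]

theorem charpoly_mul_charpoly_of_mul_eq_zero {A B : Matrix I I R} (h : A * B = 0) :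
    A.charpoly * B.charpoly = X ^ Fintype.card I * (A + B).charpoly := by
  have hmul : A.charmatrix * B.charmatrix = (X : R[X]) • (A + B).charmatrix := by
    have hC : C.mapMatrix A * C.mapMatrix B = 0 := by rw [← map_mul, h, map_zero]
    have hX : C.mapMatrix A * Matrix.scalar I X = Matrix.scalar I X * C.mapMatrix A :=
      (Matrix.scalar_commute X (Commute.all X) _).symm
    rw [Matrix.smul_eq_diagonal_mul, ← Matrix.scalar_apply]
    simp only [Matrix.charmatrix, map_add, sub_mul, mul_sub, mul_add, hC, hX]
    abel
  rw [Matrix.charpoly, Matrix.charpoly, ← Matrix.det_mul, hmul, Matrix.det_smul, Matrix.charpoly]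

theorem X_add_C_mul_charpoly {N : Matrix I I R} {τ : I → R} (hτ : τ ᵥ* N = 0) (u : I → R) :
    (X + C (τ ⬝ᵥ u)) * N.charpoly = X * (N - Matrix.vecMulVec u τ).charpoly := by
  rcases isEmpty_or_nonempty I
  · simp [Matrix.charpoly_isEmpty, dotProduct]
  obtain ⟨m, hm⟩ := Nat.exists_eq_add_one_of_ne_zero (Fintype.card_ne_zero (α := I))
  have h := charpoly_mul_charpoly_of_mul_eq_zero (A := Matrix.vecMulVec (-u) τ) (B := N)
    (by rw [Matrix.vecMulVec_mul, hτ, Matrix.vecMulVec_zero])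
  rw [Matrix.charpoly_vecMulVec, hm, add_tsub_cancel_right, neg_dotProduct, dotProduct_comm,
    Matrix.neg_vecMulVec, neg_add_eq_sub, smul_eq_C_mul, C_neg] at h
  refine (isRegular_X_pow m).left ?_
  change X ^ m * _ = X ^ m * _
  linear_combination h

theorem aroots_charpoly_erase_zero {K F : Type*} [Field K] [Field F] [DecidableEq F]
    [Algebra K F] {N : Matrix I I K} {τ : I → K} (hτ : τ ᵥ* N = 0) (u : I → K) :
    (N.charpoly.aroots F).erase 0 =
      ((N - Matrix.vecMulVec u τ).charpoly.aroots F).erase (-algebraMap K F (τ ⬝ᵥ u)) := by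
  have h : ((X + C (τ ⬝ᵥ u)) * N.charpoly).aroots F =
      (X * (N - Matrix.vecMulVec u τ).charpoly).aroots F := by rw [X_add_C_mul_charpoly hτ]
  rw [aroots_mul (mul_ne_zero (X_add_C_ne_zero _) (Matrix.charpoly_monic _).ne_zero),
    aroots_mul (mul_ne_zero X_ne_zero (Matrix.charpoly_monic _).ne_zero),
    aroots_def, Polynomial.map_add, map_X, map_C, roots_X_add_C, aroots_X, Multiset.singleton_add,
    Multiset.singleton_add] at h
  rw [← Multiset.erase_cons_head (-algebraMap K F (τ ⬝ᵥ u)) (N.charpoly.aroots F), h,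
    Multiset.erase_comm, Multiset.erase_cons_head]

end Charpoly

section RealMatrix

variable {I : Type*} [Fintype I] [DecidableEq I] {N : Matrix I I ℝ}

theorem re_le_of_mem_aroots_charpoly {δ : ℝ} (hoff : ∀ i k, i ≠ k → 0 ≤ N i k)
    (hcol : ∀ k, ∑ i, N i k ≤ -δ) {z : ℂ} (hz : z ∈ N.charpoly.aroots ℂ) : z.re ≤ -δ := by
  by_contra! hlt
  have hroot := Polynomial.isRoot_of_mem_roots hz
  rw [← Matrix.charpoly_map, Polynomial.IsRoot, Matrix.eval_charpoly] at hroot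
  refine det_ne_zero_of_sum_col_lt_diag (fun k => ?_) hroot
  have hdisc : ∑ i ∈ Finset.univ.erase k,
      ‖(Matrix.scalar I z - N.map (algebraMap ℝ ℂ)) i k‖ = ∑ i, N i k - N k k := by
    rw [← Finset.add_sum_erase _ _ (Finset.mem_univ k), add_sub_cancel_left]
    refine Finset.sum_congr rfl fun i hi => ?_
    have hik := Finset.ne_of_mem_erase hi
    simp [hik, abs_of_nonneg (hoff i k hik)]
  have hre := Complex.re_le_norm (z - N k k)
  rw [Complex.sub_re, Complex.ofReal_re] at hre
  rw [hdisc, Matrix.sub_apply, Matrix.scalar_apply, Matrix.diagonal_apply_eq, Matrix.map_apply,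
    Complex.coe_algebraMap]
  linarith [hcol k]

theorem ofReal_mem_aroots_charpoly {x : ℝ} (hx : N.charpoly.IsRoot x) :
    (x : ℂ) ∈ N.charpoly.aroots ℂ := by
  rw [Polynomial.mem_aroots, ← Complex.coe_algebraMap, Polynomial.aeval_algebraMap_apply,
    Polynomial.coe_aeval_eq_eval, hx, map_zero]
  exact ⟨(Matrix.charpoly_monic N).ne_zero, rfl⟩

theorem zero_mem_aroots_charpoly [Nonempty I] (hcol : ∀ k, ∑ i, N i k = 0) :
    0 ∈ N.charpoly.aroots ℂ := by
  have hdet : N.det = 0 := by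
    refine Matrix.exists_vecMul_eq_zero_iff.1 ⟨1, one_ne_zero, ?_⟩
    ext k
    simpa [Matrix.vecMul, dotProduct] using hcol k
  rw [← Complex.ofReal_zero]
  refine ofReal_mem_aroots_charpoly ?_
  rw [Polynomial.IsRoot, Matrix.eval_charpoly, map_zero, zero_sub, Matrix.det_neg, hdet, mul_zero]

theorem re_le_of_mem_aroots_charpoly_erase {u : I → ℝ} (hoff : ∀ i k, i ≠ k → u i ≤ N i k)
    (hcol : ∀ k, ∑ i, N i k = 0) {z : ℂ} (hz : z ∈ (N.charpoly.aroots ℂ).erase 0) :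
    z.re ≤ -∑ i, u i := by
  have hτ : (1 : I → ℝ) ᵥ* N = 0 := by
    ext k
    simpa [Matrix.vecMul, dotProduct] using hcol k
  rw [aroots_charpoly_erase_zero hτ u] at hz
  refine re_le_of_mem_aroots_charpoly (fun i k hik => ?_) (fun k => ?_)
    (Multiset.mem_of_mem_erase hz)
  · simpa [Matrix.vecMulVec_apply] using hoff i k hik
  · simp [Finset.sum_sub_distrib, hcol k]

open scoped MatrixOrder in
theorem exists_isRoot_charpoly_ge_of_isHermitian (hN : N.IsHermitian) {y : I → ℝ} (hy : y ≠ 0)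
    {r : ℝ} (hr : r * (y ⬝ᵥ y) ≤ y ⬝ᵥ N *ᵥ y) : ∃ x, r ≤ x ∧ N.charpoly.IsRoot x := by
  obtain ⟨i, -⟩ := Function.ne_iff.1 hy
  obtain ⟨j, -, hj⟩ := Finset.exists_max_image Finset.univ hN.eigenvalues ⟨i, Finset.mem_univ i⟩
  refine ⟨hN.eigenvalues j, ?_, Matrix.mem_spectrum_iff_isRoot_charpoly.1
    (hN.eigenvalues_mem_spectrum_real j)⟩
  have hle : N ≤ algebraMap ℝ (Matrix I I ℝ) (hN.eigenvalues j) := by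
    refine le_algebraMap_of_spectrum_le (fun x hx => ?_) hN.isSelfAdjoint
    rw [hN.spectrum_real_eq_range_eigenvalues] at hx
    obtain ⟨k, rfl⟩ := hx
    exact hj k (Finset.mem_univ k)
  have hquad : y ⬝ᵥ N *ᵥ y ≤ hN.eigenvalues j * (y ⬝ᵥ y) := by
    have h := (Matrix.le_iff.1 hle).dotProduct_mulVec_nonneg y
    rw [star_trivial, Matrix.sub_mulVec, dotProduct_sub, Algebra.algebraMap_eq_smul_one,
      Matrix.smul_mulVec, Matrix.one_mulVec, dotProduct_smul, smul_eq_mul] at h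
    linarith
  exact le_of_mul_le_mul_right (hr.trans hquad)
    (by simpa using Matrix.dotProduct_star_self_pos_iff.2 hy)

theorem exists_isRoot_charpoly_ge_of_detailedBalance [Nonempty I] {w : I → ℝ} (hw : ∀ i, 0 < w i)
    (hN : ∀ i k, N i k * w k ^ 2 = N k i * w i ^ 2) {r : ℝ} (hr : ∀ k, r ≤ ∑ i, N i k) :
    ∃ x, r ≤ x ∧ N.charpoly.IsRoot x := by
  have hw0 : ∀ i, w i ≠ 0 := fun i => (hw i).ne'
  set S : Matrix I I ℝ := Matrix.diagonal w⁻¹ * (N * Matrix.diagonal w) with hS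
  have hSapply : ∀ i k, S i k = (w i)⁻¹ * (N i k * w k) := fun i k => by
    rw [hS, Matrix.diagonal_mul, Matrix.mul_diagonal, Pi.inv_apply]
  have hsymm : S.IsHermitian := by
    ext i k
    rw [Matrix.conjTranspose_apply, star_trivial, hSapply, hSapply]
    have := hw0 i
    have := hw0 k
    field_simp
    linarith [hN i k]
  have hcharpoly : S.charpoly = N.charpoly := by
    have hdiag : Matrix.diagonal w * Matrix.diagonal w⁻¹ = 1 := by
      simp [Matrix.diagonal_mul_diagonal, hw0]
    rw [Matrix.charpoly_mul_comm, mul_assoc, hdiag, mul_one]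
  rw [← hcharpoly]
  refine exists_isRoot_charpoly_ge_of_isHermitian hsymm (y := w) ?_ ?_
  · exact Function.ne_iff.2 ⟨Classical.arbitrary I, hw0 _⟩
  · have hquad : w ⬝ᵥ S *ᵥ w = ∑ k, (∑ i, N i k) * (w k * w k) := by
      simp only [dotProduct, Matrix.mulVec, hSapply, Finset.mul_sum, Finset.sum_mul]
      rw [Finset.sum_comm]
      refine Finset.sum_congr rfl fun k _ => Finset.sum_congr rfl fun i _ => ?_
      have := hw0 i
      field_simp
    rw [hquad, dotProduct, Finset.mul_sum]
    gcongr with k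
    · exact mul_self_nonneg (w k)
    · exact hr k

end RealMatrix

section SpectralGap

theorem exists_mem_roots_charpoly_erase_zero {V : Type*} [Finite V] [Nontrivial V]
    (L : Module.End ℂ (Matrix V V ℂ)) : ∃ z, z ∈ L.charpoly.roots.erase 0 := by
  have := Fintype.ofFinite V
  have hcard : L.charpoly.roots.card = Fintype.card V * Fintype.card V := by
    rw [IsAlgClosed.card_roots_eq_natDegree, LinearMap.charpoly_natDegree, Module.finrank_matrix,
      Module.finrank_self, mul_one]
  have hle := Multiset.card_le_card (Multiset.le_cons_erase (a := 0) (s := L.charpoly.roots))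
  rw [hcard, Multiset.card_cons] at hle
  have hV := Fintype.one_lt_card (α := V)
  exact Multiset.card_pos_iff_exists_mem.1 (by nlinarith)

variable {V : Type*} [Fintype V] {L : Module.End ℂ (Matrix V V ℂ)}

theorem le_spectralGap [Nontrivial V] {r : ℝ} (h : ∀ z ∈ L.charpoly.roots.erase 0, r ≤ ‖z‖) :
    r ≤ spectralGap L := by
  obtain ⟨z, hz⟩ := exists_mem_roots_charpoly_erase_zero L
  refine le_csInf ⟨‖z‖, z, hz, rfl⟩ ?_
  rintro _ ⟨z, hz, rfl⟩
  exact h z hz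

theorem spectralGap_le_norm {z : ℂ} (hz : z ∈ L.charpoly.roots.erase 0) : spectralGap L ≤ ‖z‖ :=
  csInf_le ⟨0, by rintro _ ⟨z, -, rfl⟩; exact norm_nonneg z⟩ ⟨z, hz, rfl⟩

theorem spectralGap_conj (e : Matrix V V ℂ ≃ₗ[ℂ] Matrix V V ℂ) (L : Module.End ℂ (Matrix V V ℂ)) :
    spectralGap (e.conj L) = spectralGap L := by
  rw [spectralGap, LinearEquiv.charpoly_conj, spectralGap]

end SpectralGap

/-! ### Unitary covariance and diagonal Hamiltonians -/

section UnitaryCovariance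

variable {V : Type*} [Fintype V]

theorem continuous_starAlgEquiv (φ : Matrix V V ℂ ≃⋆ₐ[ℂ] Matrix V V ℂ) : Continuous φ := by
  classical exact φ.toAlgEquiv.toLinearMap.continuous_of_finiteDimensional

variable [DecidableEq V]

open scoped Matrix.Norms.Operator in
theorem exp_starAlgEquiv (φ : Matrix V V ℂ ≃⋆ₐ[ℂ] Matrix V V ℂ) (M : Matrix V V ℂ) :
    NormedSpace.exp (φ M) = φ (NormedSpace.exp M) :=
  (NormedSpace.map_exp φ (continuous_starAlgEquiv φ) M).symm

theorem energies_starAlgEquiv (φ : Matrix V V ℂ ≃⋆ₐ[ℂ] Matrix V V ℂ) (H : Matrix V V ℂ) :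
    energies (φ H) = energies H := by
  simp only [energies]
  congr 1
  exact AlgEquiv.spectrum_eq (φ.restrictScalars ℝ) H

theorem energyProj_starAlgEquiv (φ : Matrix V V ℂ ≃⋆ₐ[ℂ] Matrix V V ℂ) {H : Matrix V V ℂ}
    (hH : IsSelfAdjoint H) (E : ℝ) : energyProj (φ H) E = φ (energyProj H E) :=
  (StarAlgHomClass.map_cfc (S := ℂ) φ _ H (Matrix.finite_real_spectrum.continuousOn _)
    (continuous_starAlgEquiv φ) hH (hH.map φ)).symm

theorem bohrComponent_starAlgEquiv (φ : Matrix V V ℂ ≃⋆ₐ[ℂ] Matrix V V ℂ) {H : Matrix V V ℂ}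
    (hH : IsSelfAdjoint H) (A : Matrix V V ℂ) (ν : ℝ) :
    bohrComponent (φ H) (φ A) ν = φ (bohrComponent H A ν) := by
  simp only [bohrComponent, energies_starAlgEquiv, energyProj_starAlgEquiv φ hH, map_sum, map_mul]

theorem coherentTerm_starAlgEquiv {ι : Type*} [Fintype ι] (β σ : ℝ)
    (φ : Matrix V V ℂ ≃⋆ₐ[ℂ] Matrix V V ℂ) {H : Matrix V V ℂ} (hH : IsSelfAdjoint H)
    (A : ι → Matrix V V ℂ) :
    coherentTerm β σ (φ H) (fun a => φ (A a)) = φ (coherentTerm β σ H A) := by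
  simp only [coherentTerm, bohrFreqs, energies_starAlgEquiv, bohrComponent_starAlgEquiv φ hH,
    ← Matrix.star_eq_conjTranspose, map_sum, map_smul, map_mul, map_star]

theorem commutator_starAlgEquiv (φ : Matrix V V ℂ ≃⋆ₐ[ℂ] Matrix V V ℂ) (B : Matrix V V ℂ) :
    commutator (φ B) = φ.toAlgEquiv.toLinearEquiv.conj (commutator B) := by
  ext1 X
  simp [commutator, LinearEquiv.conj_apply]

theorem dissipator_starAlgEquiv (φ : Matrix V V ℂ ≃⋆ₐ[ℂ] Matrix V V ℂ) (K : Matrix V V ℂ) :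
    dissipator (φ K) = φ.toAlgEquiv.toLinearEquiv.conj (dissipator K) := by
  ext1 X
  simp [dissipator, LinearEquiv.conj_apply, ← Matrix.star_eq_conjTranspose, map_star]

/-- The integrand `f(t) e^{-iωt} e^{iHt} A e^{-iHt}` of the operator Fourier transform, as a
matrix. -/
noncomputable def operatorFTIntegrand (σ : ℝ) (H A : Matrix V V ℂ) (ω t : ℝ) : Matrix V V ℂ :=
  (Complex.exp (-(Complex.I * ω * t)) * window σ t) •
    (NormedSpace.exp ((Complex.I * t) • H) * A * NormedSpace.exp ((-(Complex.I * t)) • H))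

theorem operatorFT_eq_smul_integral (σ : ℝ) (H A : Matrix V V ℂ) (ω : ℝ) :
    operatorFT σ H A ω = ((1 / √(2 * Real.pi) : ℝ) : ℂ) •
      Matrix.of fun i j => ∫ t, operatorFTIntegrand σ H A ω t i j := by
  ext i j
  simp only [operatorFT, operatorFTIntegrand, Matrix.of_apply, Matrix.smul_apply, smul_eq_mul]
  congr 2
  exact funext fun t => by ring

theorem operatorFTIntegrand_starAlgEquiv (σ : ℝ) (φ : Matrix V V ℂ ≃⋆ₐ[ℂ] Matrix V V ℂ)
    (H A : Matrix V V ℂ) (ω t : ℝ) :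
    operatorFTIntegrand σ (φ H) (φ A) ω t = φ (operatorFTIntegrand σ H A ω t) := by
  simp only [operatorFTIntegrand, ← map_smul, exp_starAlgEquiv, ← map_mul]

theorem linearMap_apply_eq_sum_single (ψ : Module.End ℂ (Matrix V V ℂ)) (X : Matrix V V ℂ)
    (i j : V) : ψ X i j = ∑ p : V × V, X p.1 p.2 * ψ (Matrix.single p.1 p.2 1) i j := by
  conv_lhs => rw [Matrix.matrix_eq_sum_single X]
  simp only [map_sum, Matrix.sum_apply, Fintype.sum_prod_type]
  refine Finset.sum_congr rfl fun k _ => Finset.sum_congr rfl fun l _ => ?_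
  rw [← mul_one (X k l), ← smul_eq_mul, ← Matrix.smul_single, map_smul, Matrix.smul_apply,
    smul_eq_mul, smul_eq_mul, mul_one]

theorem integral_linearMap_apply {V : Type*} [Finite V] (ψ : Module.End ℂ (Matrix V V ℂ))
    {F : ℝ → Matrix V V ℂ} (hF : ∀ i j, Integrable fun t => F t i j) (i j : V) :
    ∫ t, ψ (F t) i j = ψ (Matrix.of fun i j => ∫ t, F t i j) i j := by
  classical
  have := Fintype.ofFinite V
  simp only [linearMap_apply_eq_sum_single ψ (F _), linearMap_apply_eq_sum_single ψ (Matrix.of _)]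
  rw [integral_finsetSum _ fun p _ => (hF _ _).mul_const _]
  simp only [integral_mul_const, Matrix.of_apply]

theorem superIntegral_apply {F : ℝ → Module.End ℂ (Matrix V V ℂ)}
    (hF : ∀ X i j, Integrable fun ω => F ω X i j) (X : Matrix V V ℂ) (i j : V) :
    superIntegral F X i j = ∫ ω, F ω X i j := by
  simp only [linearMap_apply_eq_sum_single _ X]
  rw [integral_finsetSum _ fun p _ => (hF _ _ _).const_mul _]
  refine Finset.sum_congr rfl fun p _ => ?_
  rw [integral_const_mul, superIntegral, ← Matrix.stdBasis_eq_single, Module.Basis.constr_basis,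
    Matrix.of_apply, Matrix.stdBasis_eq_single]

theorem superIntegral_conj (e : Matrix V V ℂ ≃ₗ[ℂ] Matrix V V ℂ)
    {F : ℝ → Module.End ℂ (Matrix V V ℂ)} (hF : ∀ X i j, Integrable fun ω => F ω X i j) :
    superIntegral (fun ω => e.conj (F ω)) = e.conj (superIntegral F) := by
  refine (Matrix.stdBasis ℂ V V).ext fun p => ?_
  ext i j
  rw [superIntegral, Module.Basis.constr_basis, ← Matrix.stdBasis_eq_single]
  simp only [LinearEquiv.conj_apply_apply, Matrix.of_apply]
  exact (integral_linearMap_apply e.toLinearMap (hF _) i j).trans <|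
    congrArg (fun M => e M i j) (Matrix.ext fun k l => (superIntegral_apply hF _ k l).symm)

end UnitaryCovariance

section DiagonalHamiltonian

variable {V : Type*} [DecidableEq V]

/-- The Hamiltonian that is diagonal in the standard basis, with energies `E`. -/
def diagonalHamiltonian (E : V → ℝ) : Matrix V V ℂ :=
  Matrix.diagonal fun k => (E k : ℂ)

theorem isSelfAdjoint_diagonalHamiltonian (E : V → ℝ) : IsSelfAdjoint (diagonalHamiltonian E) := by
  rw [IsSelfAdjoint, Matrix.star_eq_conjTranspose, diagonalHamiltonian,
    Matrix.diagonal_conjTranspose]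
  congr 1
  exact funext fun k => Complex.conj_ofReal _

variable [Fintype V]

theorem energies_diagonalHamiltonian (E : V → ℝ) :
    energies (diagonalHamiltonian E) = Finset.univ.image E := by
  ext x
  rw [energies, Set.Finite.mem_toFinset, ← spectrum.algebraMap_mem_iff ℂ, diagonalHamiltonian,
    spectrum_diagonal]
  simp

theorem cfc_diagonalHamiltonian (f : ℝ → ℝ) (E : V → ℝ) :
    cfc f (diagonalHamiltonian E) = diagonalHamiltonian (f ∘ E) := by
  set p := Lagrange.interpolate (Finset.univ.image E) id f
  have heval : ∀ k, p.eval (E k) = f (E k) := fun k =>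
    Lagrange.eval_interpolate_at_node (v := id) f Function.injective_id.injOn
      (Finset.mem_image_of_mem E (Finset.mem_univ k))
  have hcfc : cfc f (diagonalHamiltonian E) = cfc p.eval (diagonalHamiltonian E) := by
    refine cfc_congr fun x hx => ?_
    have hx' : x ∈ energies (diagonalHamiltonian E) := (Set.Finite.mem_toFinset _).2 hx
    rw [energies_diagonalHamiltonian, Finset.mem_image] at hx'
    obtain ⟨k, -, rfl⟩ := hx'
    exact (heval k).symm
  have haeval : Polynomial.aeval (fun k => (E k : ℂ)) p = fun k => (f (E k) : ℂ) := by
    rw [Polynomial.aeval_pi_apply]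
    ext k
    rw [← heval k]
    exact Polynomial.aeval_algebraMap_apply ℂ (E k) p
  rw [hcfc, cfc_polynomial p _ (isSelfAdjoint_diagonalHamiltonian E)]
  exact (Polynomial.aeval_algHom_apply (Matrix.diagonalAlgHom ℝ) (fun k => (E k : ℂ)) p).trans
    (congrArg Matrix.diagonal haeval)

theorem energyProj_diagonalHamiltonian (E : V → ℝ) (x : ℝ) :
    energyProj (diagonalHamiltonian E) x = Matrix.diagonal fun k => if E k = x then 1 else 0 := by
  rw [energyProj, cfc_diagonalHamiltonian, diagonalHamiltonian]
  congr 1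
  ext k
  simp [Pi.single_apply, apply_ite]

theorem bohrComponent_diagonalHamiltonian (E : V → ℝ) (A : Matrix V V ℂ) (ν : ℝ) (k l : V) :
    bohrComponent (diagonalHamiltonian E) A ν k l = if E k - E l = ν then A k l else 0 := by
  simp only [bohrComponent, energies_diagonalHamiltonian, energyProj_diagonalHamiltonian,
    Matrix.sum_apply, Matrix.mul_diagonal, Matrix.diagonal_mul]
  rw [Finset.sum_eq_single_of_mem (E l) (Finset.mem_image_of_mem E (Finset.mem_univ l))]
  · simp [sub_eq_iff_eq_add']
  · intro x _ hx
    simp [hx.symm]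

theorem exp_smul_diagonalHamiltonian (E : V → ℝ) (c : ℂ) :
    NormedSpace.exp (c • diagonalHamiltonian E) =
      Matrix.diagonal fun k => Complex.exp (c * E k) := by
  rw [diagonalHamiltonian, ← Matrix.diagonal_smul, Matrix.exp_diagonal]
  congr 1
  ext k
  rw [Pi.coe_exp]
  simp [Complex.exp_eq_exp_ℂ]

theorem fourierIntegral_window {σ : ℝ} (hσ : 0 < σ) (ν : ℝ) :
    ∫ t : ℝ, Complex.exp (Complex.I * ν * t) * window σ t = √(2 * Real.pi) * windowHat σ ν := by
  have hfactor : ∀ t : ℝ, Complex.exp (Complex.I * ν * t) * window σ t =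
      (√(σ * √(2 / Real.pi)) : ℝ) *
        (Complex.exp (Complex.I * ν * t) * Complex.exp (-((σ ^ 2 : ℝ) : ℂ) * t ^ 2)) := by
    intro t
    rw [window]
    push_cast
    ring
  have hroot : ((Real.pi : ℂ) / ((σ ^ 2 : ℝ) : ℂ)) ^ (1 / 2 : ℂ) = (√(Real.pi / σ ^ 2) : ℝ) := by
    rw [Real.sqrt_eq_rpow, Complex.ofReal_cpow (by positivity)]
    push_cast
    rfl
  have hconst : √(σ * √(2 / Real.pi)) * √(Real.pi / σ ^ 2) =
      √(2 * Real.pi) * (1 / √(σ * √(2 * Real.pi))) := by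
    have hpi : √(2 * Real.pi) * √(2 / Real.pi) = 2 := by
      rw [← Real.sqrt_mul (by positivity), show 2 * Real.pi * (2 / Real.pi) = 2 ^ 2 by
        field_simp, Real.sqrt_sq (by norm_num)]
    have : 0 < √(2 * Real.pi) := by positivity
    rw [one_div, ← Real.sqrt_inv, ← Real.sqrt_mul (by positivity), ← Real.sqrt_mul (by positivity)]
    congr 1
    field_simp
    linear_combination hpi
  simp_rw [hfactor]
  rw [integral_const_mul, fourierIntegral_gaussian (by rw [Complex.ofReal_re]; positivity), hroot,
    windowHat, ← mul_assoc, ← Complex.ofReal_mul, hconst]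
  push_cast
  rw [mul_assoc]

theorem integrable_exp_mul_window {σ : ℝ} (hσ : 0 < σ) (ν : ℝ) :
    Integrable fun t : ℝ => Complex.exp (Complex.I * ν * t) * window σ t := by
  have h : Integrable fun t : ℝ => (window σ t : ℂ) :=
    ((integrable_exp_neg_mul_sq (b := σ ^ 2) (by positivity)).mul_const _).ofReal
  refine h.bdd_mul (c := 1) (by fun_prop : Continuous _).aestronglyMeasurable
    (ae_of_all _ fun t => ?_)
  rw [Complex.norm_exp]
  simp

theorem operatorFTIntegrand_diagonalHamiltonian (σ : ℝ) (E : V → ℝ) (A : Matrix V V ℂ)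
    (ω t : ℝ) (k l : V) :
    operatorFTIntegrand σ (diagonalHamiltonian E) A ω t k l =
      Complex.exp (Complex.I * ((E k - E l - ω : ℝ) : ℂ) * t) * window σ t * A k l := by
  have hexp : Complex.exp (Complex.I * ((E k - E l - ω : ℝ) : ℂ) * t) =
      Complex.exp (Complex.I * t * E k) * Complex.exp (-(Complex.I * t) * E l) *
        Complex.exp (-(Complex.I * ω * t)) := by
    rw [← Complex.exp_add, ← Complex.exp_add]
    push_cast
    ring_nf
  rw [operatorFTIntegrand, Matrix.smul_apply, exp_smul_diagonalHamiltonian,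
    exp_smul_diagonalHamiltonian, Matrix.mul_diagonal, Matrix.diagonal_mul, hexp, smul_eq_mul]
  ring

theorem operatorFT_diagonalHamiltonian {σ : ℝ} (hσ : 0 < σ) (E : V → ℝ) (A : Matrix V V ℂ)
    (ω : ℝ) (k l : V) :
    operatorFT σ (diagonalHamiltonian E) A ω k l = windowHat σ (ω - (E k - E l)) * A k l := by
  have hpi : (√(2 * Real.pi) : ℂ) ≠ 0 := by
    exact_mod_cast (by positivity : √(2 * Real.pi) ≠ 0)
  rw [operatorFT_eq_smul_integral]
  simp only [Matrix.smul_apply, Matrix.of_apply, operatorFTIntegrand_diagonalHamiltonian]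
  rw [integral_mul_const, fourierIntegral_window hσ, ← windowHat_neg, neg_sub]
  rw [smul_eq_mul]
  push_cast
  field_simp

theorem operatorFT_starAlgEquiv {σ : ℝ} (hσ : 0 < σ) (φ : Matrix V V ℂ ≃⋆ₐ[ℂ] Matrix V V ℂ)
    (E : V → ℝ) (A : Matrix V V ℂ) (ω : ℝ) :
    operatorFT σ (φ (diagonalHamiltonian E)) (φ A) ω =
      φ (operatorFT σ (diagonalHamiltonian E) A ω) := by
  have hint : ∀ k l, Integrable fun t =>
      operatorFTIntegrand σ (diagonalHamiltonian E) A ω t k l := fun k l => by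
    simp only [operatorFTIntegrand_diagonalHamiltonian]
    exact (integrable_exp_mul_window hσ _).mul_const _
  rw [operatorFT_eq_smul_integral, operatorFT_eq_smul_integral, map_smul]
  congr 1
  ext i j
  simp only [operatorFTIntegrand_starAlgEquiv]
  exact integral_linearMap_apply φ.toAlgEquiv.toLinearMap hint i j

end DiagonalHamiltonian

/-! ### The Kossakowski form of the Lindbladian -/

section DiagonalLindbladian

variable {V ι : Type*} [Fintype ι]

/-- The correlations `C(p, q) = ∑_a A^a_p (A^a_q)*` between the matrix elements of a family of jump
operators; the Lindbladian depends on the jumps only through them. -/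
def correlation (A : ι → Matrix V V ℂ) (p q : V × V) : ℂ :=
  ∑ a, A a p.1 p.2 * star (A a q.1 q.2)

variable [Fintype V]

/-- The value at `X` of the Lindblad generator
`X ↦ ∑_{p,q} w_{pq} (e_p X e_q† - (1/2) {e_q† e_p, X})` with Kossakowski matrix `w` in the basis
`e_{(k,l)} = |k⟩⟨l|` of matrix units. It is the common form of the dissipators `K X K† - …`, where
`w_{pq} = K_p K_q*`, and of their sums and integrals, being linear in `w`. -/
noncomputable def kossakowskiDissipator (w : V × V → V × V → ℂ) (X : Matrix V V ℂ) : Matrix V V ℂ :=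
  Matrix.of fun i j => ∑ p : V × V, w (i, p.1) (j, p.2) * X p.1 p.2 -
    1 / 2 * (∑ p : V × V, w p (p.1, i) * X p.2 j + ∑ p : V × V, w (p.1, j) p * X i p.2)

theorem smul_kossakowskiDissipator (c : ℂ) (w : V × V → V × V → ℂ) (X : Matrix V V ℂ) :
    c • kossakowskiDissipator w X = kossakowskiDissipator (fun p q => c * w p q) X := by
  ext i j
  simp only [kossakowskiDissipator, Matrix.smul_apply, Matrix.of_apply, smul_eq_mul, mul_assoc,
    ← Finset.mul_sum]
  ring

theorem sum_kossakowskiDissipator {α : Type*} (s : Finset α) (w : α → V × V → V × V → ℂ)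
    (X : Matrix V V ℂ) : ∑ a ∈ s, kossakowskiDissipator (w a) X =
      kossakowskiDissipator (fun p q => ∑ a ∈ s, w a p q) X := by
  ext i j
  simp only [kossakowskiDissipator, Matrix.sum_apply, Matrix.of_apply, Finset.sum_sub_distrib,
    ← Finset.mul_sum, Finset.sum_add_distrib, Finset.sum_mul,
    Finset.sum_comm (s := s) (t := Finset.univ)]

theorem integrable_kossakowskiDissipator {w : ℝ → V × V → V × V → ℂ}
    (hw : ∀ p q, Integrable fun ω => w ω p q) (X : Matrix V V ℂ) (i j : V) :
    Integrable fun ω => kossakowskiDissipator (w ω) X i j := by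
  simp only [kossakowskiDissipator, Matrix.of_apply]
  have hsum (p q : V × V → V × V) (x : V × V → ℂ) :
      Integrable fun ω => ∑ r, w ω (p r) (q r) * x r :=
    integrable_finsetSum _ fun r _ => (hw _ _).mul_const _
  exact (hsum _ _ _).sub (((hsum _ _ _).add (hsum _ _ _)).const_mul _)

theorem integral_kossakowskiDissipator {w : ℝ → V × V → V × V → ℂ}
    (hw : ∀ p q, Integrable fun ω => w ω p q) (X : Matrix V V ℂ) (i j : V) :
    ∫ ω, kossakowskiDissipator (w ω) X i j =
      kossakowskiDissipator (fun p q => ∫ ω, w ω p q) X i j := by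
  have hsum (p q : V × V → V × V) (x : V × V → ℂ) :
      Integrable fun ω => ∑ r, w ω (p r) (q r) * x r :=
    integrable_finsetSum _ fun r _ => (hw _ _).mul_const _
  have hint (p q : V × V → V × V) (x : V × V → ℂ) :
      ∫ ω, ∑ r, w ω (p r) (q r) * x r = ∑ r, (∫ ω, w ω (p r) (q r)) * x r := by
    rw [integral_finsetSum _ fun r _ => (hw _ _).mul_const _]
    simp only [integral_mul_const]
  have hgain := hsum (fun p => (i, p.1)) (fun p => (j, p.2)) fun p => X p.1 p.2
  have hlossL := hsum (fun p => p) (fun p => (p.1, i)) fun p => X p.2 j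
  have hlossR := hsum (fun p => (p.1, j)) (fun p => p) fun p => X i p.2
  simp only [kossakowskiDissipator, Matrix.of_apply]
  refine (integral_sub hgain ((hlossL.add hlossR).const_mul _)).trans ?_
  rw [integral_const_mul, integral_add' hlossL hlossR, hint, hint, hint]

variable [DecidableEq V]

theorem coherentTerm_diagonalHamiltonian_apply (β σ : ℝ) (E : V → ℝ) (A : ι → Matrix V V ℂ)
    (i j : V) :
    coherentTerm β σ (diagonalHamiltonian E) A i j =
      ∑ k, ((Real.tanh (-β * ((E k - E j) - (E k - E i)) / 4) *
        theta β σ (E k - E j) (E k - E i) : ℝ) / (2 * Complex.I) : ℂ) *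
          correlation A (k, j) (k, i) := by
  set c : ℝ → ℝ → ℂ := fun ν₁ ν₂ =>
    ((Real.tanh (-β * (ν₁ - ν₂) / 4) * theta β σ ν₁ ν₂ : ℝ) / (2 * Complex.I) : ℂ)
  have hmem : ∀ k l, E k - E l ∈ bohrFreqs (diagonalHamiltonian E) := fun k l => by
    simp only [bohrFreqs, energies_diagonalHamiltonian]
    exact Finset.mem_image₂_of_mem (Finset.mem_image_of_mem E (Finset.mem_univ k))
      (Finset.mem_image_of_mem E (Finset.mem_univ l))
  have hsingle : ∀ a, ∑ ν₁ ∈ bohrFreqs (diagonalHamiltonian E),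
      ∑ ν₂ ∈ bohrFreqs (diagonalHamiltonian E), c ν₁ ν₂ *
        ((bohrComponent (diagonalHamiltonian E) (A a) ν₂)ᴴ *
          bohrComponent (diagonalHamiltonian E) (A a) ν₁) i j =
      ∑ k, c (E k - E j) (E k - E i) * (A a k j * star (A a k i)) := by
    intro a
    simp only [Matrix.mul_apply, Matrix.conjTranspose_apply, bohrComponent_diagonalHamiltonian,
      Finset.mul_sum]
    simp only [Finset.sum_comm (s := bohrFreqs _) (t := Finset.univ), apply_ite star, star_zero,
      ite_mul, mul_ite, zero_mul, mul_zero, Finset.sum_ite_irrel, Finset.sum_const_zero,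
      Finset.sum_ite_eq, hmem, if_true, mul_comm (star _)]
  simp only [coherentTerm, Matrix.sum_apply, Matrix.smul_apply, smul_eq_mul]
  refine (Finset.sum_congr rfl fun a _ => hsingle a).trans ?_
  simp only [correlation, Finset.mul_sum, Finset.sum_comm (s := Finset.univ (α := ι))]
  rfl

theorem coherentTerm_diagonalHamiltonian_eq_zero (β σ : ℝ) (E : V → ℝ) {A : ι → Matrix V V ℂ}
    (hA : ∀ k l l', l ≠ l' → correlation A (k, l) (k, l') = 0) :
    coherentTerm β σ (diagonalHamiltonian E) A = 0 := by
  ext i j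
  rw [coherentTerm_diagonalHamiltonian_apply]
  refine Finset.sum_eq_zero fun k _ => ?_
  rcases eq_or_ne j i with rfl | hji
  · simp
  · rw [hA k j i hji, mul_zero]

theorem dissipator_eq_kossakowskiDissipator (K X : Matrix V V ℂ) :
    dissipator K X = kossakowskiDissipator (fun p q => K p.1 p.2 * star (K q.1 q.2)) X := by
  ext i j
  simp only [dissipator, kossakowskiDissipator, LinearMap.sub_apply, LinearMap.comp_apply,
    LinearMap.smul_apply, LinearMap.add_apply, LinearMap.mulLeft_apply, LinearMap.mulRight_apply,
    Matrix.sub_apply, Matrix.smul_apply, Matrix.add_apply, smul_eq_mul, Matrix.mul_apply,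
    Matrix.conjTranspose_apply, Matrix.of_apply, Fintype.sum_prod_type, Finset.mul_sum,
    Finset.sum_mul]
  congr 1
  · exact Finset.sum_congr rfl fun k _ => Finset.sum_congr rfl fun l _ => by ring
  · rw [Finset.sum_comm, Finset.sum_comm (f := fun k l => X i k * _)]
    congr 2 <;>
      exact Finset.sum_congr rfl fun k _ => Finset.sum_congr rfl fun l _ => by ring

theorem filter_smul_dissipator_operatorFT (β : ℝ) {σ : ℝ} (hσ : 0 < σ) (E : V → ℝ)
    (A X : Matrix V V ℂ) (ω : ℝ) :
    ((filter β σ ω : ℂ) • dissipator (operatorFT σ (diagonalHamiltonian E) A ω)) X =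
      kossakowskiDissipator (fun p q => ((windowHat σ (ω - (E p.1 - E p.2)) *
        windowHat σ (ω - (E q.1 - E q.2)) * filter β σ ω : ℝ) : ℂ) *
          (A p.1 p.2 * star (A q.1 q.2))) X := by
  rw [LinearMap.smul_apply, dissipator_eq_kossakowskiDissipator, smul_kossakowskiDissipator]
  congr 1
  ext p q
  rw [operatorFT_diagonalHamiltonian hσ, operatorFT_diagonalHamiltonian hσ, star_mul',
    RCLike.star_def, Complex.conj_ofReal]
  push_cast
  ring

theorem integrable_filter_smul_dissipator_operatorFT {β σ : ℝ} (hβ : 0 ≤ β) (hσ : 0 < σ)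
    (E : V → ℝ) (A X : Matrix V V ℂ) (i j : V) :
    Integrable fun ω =>
      ((filter β σ ω : ℂ) • dissipator (operatorFT σ (diagonalHamiltonian E) A ω)) X i j := by
  simp only [filter_smul_dissipator_operatorFT β hσ]
  exact integrable_kossakowskiDissipator
    (fun p q => (integrable_theta hβ hσ _ _).ofReal.mul_const _) X i j

theorem superIntegral_filter_smul_dissipator_operatorFT {β σ : ℝ} (hβ : 0 ≤ β) (hσ : 0 < σ)
    (E : V → ℝ) (A X : Matrix V V ℂ) :
    superIntegral (fun ω =>
      (filter β σ ω : ℂ) • dissipator (operatorFT σ (diagonalHamiltonian E) A ω)) X =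
      kossakowskiDissipator (fun p q => (theta β σ (E p.1 - E p.2) (E q.1 - E q.2) : ℂ) *
        (A p.1 p.2 * star (A q.1 q.2))) X := by
  ext i j
  rw [superIntegral_apply (integrable_filter_smul_dissipator_operatorFT hβ hσ E A)]
  simp only [filter_smul_dissipator_operatorFT β hσ]
  refine (integral_kossakowskiDissipator
    (fun p q => (integrable_theta hβ hσ _ _).ofReal.mul_const _) X i j).trans ?_
  simp only [integral_mul_const, theta, ← integral_complex_ofReal]
  rfl

theorem lindbladian_diagonalHamiltonian_apply {β σ : ℝ} (hβ : 0 ≤ β) (hσ : 0 < σ) (E : V → ℝ)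
    {A : ι → Matrix V V ℂ} (hA : ∀ k l l', l ≠ l' → correlation A (k, l) (k, l') = 0)
    (X : Matrix V V ℂ) :
    lindbladian β σ (diagonalHamiltonian E) A X =
      kossakowskiDissipator (fun p q => theta β σ (E p.1 - E p.2) (E q.1 - E q.2) *
        correlation A p q) X := by
  have hcomm : commutator (0 : Matrix V V ℂ) = 0 := by
    ext1 X
    simp [commutator]
  rw [lindbladian, coherentTerm_diagonalHamiltonian_eq_zero β σ E hA, hcomm, smul_zero, zero_add,
    LinearMap.sum_apply]
  simp only [superIntegral_filter_smul_dissipator_operatorFT hβ hσ, sum_kossakowskiDissipator,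
    correlation, Finset.mul_sum]

theorem lindbladian_starAlgEquiv {β σ : ℝ} (hβ : 0 ≤ β) (hσ : 0 < σ)
    (φ : Matrix V V ℂ ≃⋆ₐ[ℂ] Matrix V V ℂ) (E : V → ℝ) (A : ι → Matrix V V ℂ) :
    lindbladian β σ (φ (diagonalHamiltonian E)) (fun a => φ (A a)) =
      φ.toAlgEquiv.toLinearEquiv.conj (lindbladian β σ (diagonalHamiltonian E) A) := by
  have hF (a : ι) : superIntegral (fun ω => (filter β σ ω : ℂ) •
      dissipator (operatorFT σ (φ (diagonalHamiltonian E)) (φ (A a)) ω)) =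
      φ.toAlgEquiv.toLinearEquiv.conj (superIntegral fun ω => (filter β σ ω : ℂ) •
        dissipator (operatorFT σ (diagonalHamiltonian E) (A a) ω)) := by
    rw [← superIntegral_conj _ (integrable_filter_smul_dissipator_operatorFT hβ hσ E (A a))]
    simp only [operatorFT_starAlgEquiv hσ, dissipator_starAlgEquiv, map_smul]
  simp only [lindbladian, hF, map_add, map_sum, map_smul, commutator_starAlgEquiv,
    coherentTerm_starAlgEquiv β σ φ (isSelfAdjoint_diagonalHamiltonian E)]

end DiagonalLindbladian

/-! ### Momentum sectors -/

theorem kossakowskiDissipator_single {V : Type*} [Fintype V] [DecidableEq V]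
    (w : V × V → V × V → ℂ) (k l i j : V) :
    kossakowskiDissipator w (Matrix.single k l 1) i j = w (i, k) (j, l) -
      1 / 2 * ((if l = j then ∑ a, w (a, k) (a, i) else 0) +
        if k = i then ∑ a, w (a, j) (a, l) else 0) := by
  simp [kossakowskiDissipator, Matrix.single_apply, Fintype.sum_prod_type, ite_and,
    Finset.sum_ite_irrel]

section Sectors

variable {G : Type*} [AddCommGroup G] [Fintype G] [DecidableEq G]

/-- The rate matrix on the span of the matrix units `|k + q⟩⟨k|`, `k : G`, which is an invariant
subspace of a Lindbladian with transition kernel `θ` and translation covariant correlations; the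
index `k` stands for `|k + q⟩⟨k|`, and `q = 0` is the sector of the populations. -/
noncomputable def sectorMatrix (θ : ℝ → ℝ → ℝ) (E : G → ℝ) (q : G) : Matrix G G ℝ :=
  Matrix.of fun j k => θ (E (j + q) - E (k + q)) (E j - E k) -
    if j = k then
      1 / 2 * ∑ i, (θ (E i - E (k + q)) (E i - E (k + q)) + θ (E i - E k) (E i - E k))
    else 0

/-- The kernel of the Kossakowski dissipator of a Lindbladian with transition kernel `θ` whose jump
correlations `∑ a, A a p.1 p.2 * star (A a q.1 q.2)` are the indicator of `p.1 - p.2 = q.1 - q.2`;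
any other constant strength is absorbed in `θ`. -/
noncomputable def covariantKernel (θ : ℝ → ℝ → ℝ) (E : G → ℝ) (p q : G × G) : ℂ :=
  if p.1 - p.2 = q.1 - q.2 then (θ (E p.1 - E p.2) (E q.1 - E q.2) : ℂ) else 0

variable {θ : ℝ → ℝ → ℝ} {E : G → ℝ} {L : Module.End ℂ (Matrix G G ℂ)}

theorem kossakowskiDissipator_covariantKernel_single (θ : ℝ → ℝ → ℝ) (E : G → ℝ) (k q j r : G) :
    kossakowskiDissipator (covariantKernel θ E) (Matrix.single (k + q) k 1) (j + r) j =
      if r = q then (sectorMatrix θ E r j k : ℂ) else 0 := by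
  have hshift : j + r - (k + q) = j - k ↔ r = q := by
    rw [add_sub_add_comm, add_eq_left, sub_eq_zero]
  rw [kossakowskiDissipator_single]
  simp only [covariantKernel, sub_right_inj, hshift, sectorMatrix, Matrix.of_apply]
  rcases eq_or_ne r q with rfl | hr
  · rcases eq_or_ne j k with rfl | hjk
    · simp [Finset.sum_add_distrib]
    · simp [hjk, hjk.symm]
  · rcases eq_or_ne j k with rfl | hjk
    · simp [hr, hr.symm]
    · simp [hr, hjk.symm, hjk]

theorem roots_charpoly_eq_sum_aroots_sectorMatrix
    (hL : ∀ X, L X = kossakowskiDissipator (covariantKernel θ E) X) :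
    L.charpoly.roots = ∑ q, (sectorMatrix θ E q).charpoly.aroots ℂ := by
  let e : G × G ≃ G × G := (Equiv.prodShear (Equiv.refl G) Equiv.addLeft).trans (Equiv.prodComm G G)
  have hrepr : ∀ X p, (Matrix.stdBasis ℂ G G).repr X p = X p.1 p.2 := fun _ _ => rfl
  have hblock : LinearMap.toMatrix (Matrix.stdBasis ℂ G G) (Matrix.stdBasis ℂ G G) L =
      Matrix.reindex e e
        (Matrix.blockDiagonal fun q => (sectorMatrix θ E q).map (algebraMap ℝ ℂ)) := by
    rw [← Equiv.symm_apply_eq]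
    ext ⟨j, r⟩ ⟨k, q⟩
    simpa [e, LinearMap.toMatrix_apply, Matrix.blockDiagonal_apply, Matrix.stdBasis_eq_single,
      hrepr, hL] using kossakowskiDissipator_covariantKernel_single θ E k q j r
  rw [← LinearMap.charpoly_toMatrix L (Matrix.stdBasis ℂ G G), hblock, Matrix.charpoly_reindex,
    charpoly_blockDiagonal, Polynomial.roots_prod _ _
      (Finset.prod_ne_zero_iff.2 fun q _ => (Matrix.charpoly_monic _).ne_zero)]
  simp only [Matrix.charpoly_map, Polynomial.aroots_def]
  rfl

theorem sum_sectorMatrix (θ : ℝ → ℝ → ℝ) (E : G → ℝ) (q k : G) :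
    ∑ j, sectorMatrix θ E q j k =
      -(1 / 2 * ∑ j, defect θ (E (j + q) - E (k + q)) (E j - E k)) := by
  have hshift : ∑ i, θ (E i - E (k + q)) (E i - E (k + q)) =
      ∑ j, θ (E (j + q) - E (k + q)) (E (j + q) - E (k + q)) :=
    (Equiv.sum_comp (Equiv.addRight q) fun i => θ (E i - E (k + q)) (E i - E (k + q))).symm
  simp only [sectorMatrix, defect, Matrix.of_apply, Finset.sum_sub_distrib, Finset.sum_add_distrib,
    Finset.sum_ite_eq', Finset.mem_univ, if_true, hshift, ← Finset.mul_sum]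
  ring

theorem sum_sectorMatrix_zero (θ : ℝ → ℝ → ℝ) (E : G → ℝ) (k : G) :
    ∑ j, sectorMatrix θ E 0 j k = 0 := by
  rw [sum_sectorMatrix, neg_eq_zero, mul_eq_zero_iff_left (by norm_num)]
  refine Finset.sum_eq_zero fun j _ => ?_
  simp only [defect, add_zero]
  ring

theorem re_le_of_mem_aroots_sectorMatrix_zero {c : ℝ}
    (hθ : ∀ i k, c ≤ θ (E i - E k) (E i - E k)) {z : ℂ}
    (hz : z ∈ ((sectorMatrix θ E 0).charpoly.aroots ℂ).erase 0) : z.re ≤ -(Fintype.card G * c) := by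
  have h := re_le_of_mem_aroots_charpoly_erase (u := fun _ => c) (fun i k hik => ?_)
    (sum_sectorMatrix_zero θ E) hz
  · simpa using h
  · simpa [sectorMatrix, hik] using hθ i k

theorem re_le_of_mem_aroots_sectorMatrix {δ : ℝ} {q : G} (hθ : ∀ a b, 0 ≤ θ a b)
    (hδ : ∀ k, δ ≤ ∑ j, defect θ (E (j + q) - E (k + q)) (E j - E k)) {z : ℂ}
    (hz : z ∈ (sectorMatrix θ E q).charpoly.aroots ℂ) : z.re ≤ -(1 / 2 * δ) := by
  refine re_le_of_mem_aroots_charpoly (fun i k hik => ?_) (fun k => ?_) hz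
  · simpa [sectorMatrix, hik] using hθ _ _
  · rw [sum_sectorMatrix]
    linarith [hδ k]

theorem exists_isRoot_charpoly_sectorMatrix_ge {β δ : ℝ} {q : G}
    (hθ : ∀ a b, θ (-a) (-b) = Real.exp (β * (a + b) / 2) * θ a b)
    (hδ : ∀ k, ∑ j, defect θ (E (j + q) - E (k + q)) (E j - E k) ≤ δ) :
    ∃ x, -(1 / 2 * δ) ≤ x ∧ (sectorMatrix θ E q).charpoly.IsRoot x := by
  have hbalance : ∀ i k, sectorMatrix θ E q i k * Real.exp (-β * (E (k + q) + E k) / 4) ^ 2 =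
      sectorMatrix θ E q k i * Real.exp (-β * (E (i + q) + E i) / 4) ^ 2 := by
    intro i k
    rcases eq_or_ne i k with rfl | hik
    · rfl
    have hneg := hθ (E (i + q) - E (k + q)) (E i - E k)
    rw [neg_sub, neg_sub] at hneg
    simp only [sectorMatrix, Matrix.of_apply, hik, hik.symm, if_false, sub_zero, hneg]
    rw [mul_right_comm, mul_comm, ← Real.exp_nat_mul, ← Real.exp_nat_mul, ← Real.exp_add]
    congr 2
    push_cast
    ring
  refine exists_isRoot_charpoly_ge_of_detailedBalance (fun i => Real.exp_pos _) hbalance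
    fun k => ?_
  rw [sum_sectorMatrix]
  linarith [hδ k]

theorem roots_charpoly_erase_zero_eq_sum_aroots_sectorMatrix
    (hL : ∀ X, L X = kossakowskiDissipator (covariantKernel θ E) X) :
    L.charpoly.roots.erase 0 = ((sectorMatrix θ E 0).charpoly.aroots ℂ).erase 0 +
      ∑ q ∈ Finset.univ.erase 0, (sectorMatrix θ E q).charpoly.aroots ℂ := by
  rw [roots_charpoly_eq_sum_aroots_sectorMatrix hL, ← Finset.add_sum_erase _ _ (Finset.mem_univ 0),
    Multiset.erase_add_left_pos _ (zero_mem_aroots_charpoly (sum_sectorMatrix_zero θ E))]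

theorem le_spectralGap_of_covariantKernel [Nontrivial G] {c δ : ℝ}
    (hL : ∀ X, L X = kossakowskiDissipator (covariantKernel θ E) X) (hθ : ∀ a b, 0 ≤ θ a b)
    (hc : ∀ i k, c ≤ θ (E i - E k) (E i - E k))
    (hδ : ∀ q ≠ 0, ∀ k, δ ≤ ∑ j, defect θ (E (j + q) - E (k + q)) (E j - E k)) :
    min (Fintype.card G * c) (1 / 2 * δ) ≤ spectralGap L := by
  refine le_spectralGap fun z hz => ?_
  have hre : z.re ≤ -min (Fintype.card G * c) (1 / 2 * δ) := by
    rw [roots_charpoly_erase_zero_eq_sum_aroots_sectorMatrix hL, Multiset.mem_add,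
      Multiset.mem_sum] at hz
    obtain hz | ⟨q, hq, hz⟩ := hz
    · exact (re_le_of_mem_aroots_sectorMatrix_zero hc hz).trans (neg_le_neg (min_le_left _ _))
    · exact (re_le_of_mem_aroots_sectorMatrix hθ (hδ q (Finset.ne_of_mem_erase hq)) hz).trans
        (neg_le_neg (min_le_right _ _))
  linarith [(abs_le.1 (Complex.abs_re_le_norm z)).1]

theorem spectralGap_le_of_covariantKernel {β δ : ℝ} {q : G}
    (hL : ∀ X, L X = kossakowskiDissipator (covariantKernel θ E) X) (hθ : ∀ a b, 0 ≤ θ a b)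
    (hdefect : ∀ a b, 0 ≤ defect θ a b) (hq : q ≠ 0)
    (hbalance : ∀ a b, θ (-a) (-b) = Real.exp (β * (a + b) / 2) * θ a b)
    (hδ : ∀ k, ∑ j, defect θ (E (j + q) - E (k + q)) (E j - E k) ≤ δ) :
    spectralGap L ≤ 1 / 2 * δ := by
  obtain ⟨x, hx, hroot⟩ := exists_isRoot_charpoly_sectorMatrix_ge hbalance hδ
  have hmem := ofReal_mem_aroots_charpoly hroot
  have hx0 : x ≤ 0 := by
    simpa using re_le_of_mem_aroots_sectorMatrix (δ := 0) hθ
      (fun k => Finset.sum_nonneg fun j _ => hdefect _ _) hmem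
  have hgap := spectralGap_le_norm (L := L) (z := x) <| by
    rw [roots_charpoly_erase_zero_eq_sum_aroots_sectorMatrix hL, Multiset.mem_add, Multiset.mem_sum]
    exact Or.inr ⟨q, Finset.mem_erase.2 ⟨hq, Finset.mem_univ q⟩, hmem⟩
  rw [Complex.norm_real, Real.norm_of_nonpos hx0] at hgap
  linarith

end Sectors

/-! ### Energies of Cayley graphs -/

section CharEnergy

variable {G : Type*} [AddCommGroup G]

/-- The energies `χ k + χ (-k)` of the adjacency operator of a Cayley graph with steps `±1` on the
vertex group, where `χ` is a character of the momentum group `G` (the pairing with the step `1`). -/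
def charEnergy (χ : AddChar G ℂ) (k : G) : ℝ := 2 * (χ k).re

variable {χ : AddChar G ℂ}

theorem charEnergy_add_sub (χ : AddChar G ℂ) (k q : G) :
    charEnergy χ (k + q) - charEnergy χ k = 2 * ((χ q - 1) * χ k).re := by
  rw [charEnergy, charEnergy, AddChar.map_add_eq_mul, sub_one_mul, Complex.sub_re, mul_comm (χ q)]
  ring

theorem abs_charEnergy_sub_le [Finite G] (χ : AddChar G ℂ) (i k : G) :
    |charEnergy χ i - charEnergy χ k| ≤ 4 := by
  rw [charEnergy, charEnergy, ← mul_sub, ← Complex.sub_re, abs_mul, abs_two]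
  have h := (Complex.abs_re_le_norm (χ i - χ k)).trans (norm_sub_le _ _)
  rw [AddChar.norm_apply, AddChar.norm_apply] at h
  linarith

variable [Fintype G]

theorem sum_re_mul_addChar (hχ : χ ≠ 1) (w : ℂ) : ∑ k, (w * χ k).re = 0 := by
  rw [← Complex.re_sum, ← Finset.mul_sum, AddChar.sum_eq_zero_of_ne_one hχ, mul_zero,
    Complex.zero_re]

theorem sum_re_mul_addChar_sq (hχ : χ ^ 2 ≠ 1) (w : ℂ) :
    ∑ k, (w * χ k).re ^ 2 = 1 / 2 * Fintype.card G * ‖w‖ ^ 2 := by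
  have hsq : ∀ k, (w * χ k).re ^ 2 = 1 / 2 * ‖w‖ ^ 2 + 1 / 2 * (w ^ 2 * (χ ^ 2) k).re := by
    intro k
    have hnorm : ‖w‖ ^ 2 = ‖w * χ k‖ ^ 2 := by rw [norm_mul, AddChar.norm_apply, mul_one]
    rw [hnorm, AddChar.pow_apply, ← mul_pow, sq (w * χ k), Complex.sq_norm, Complex.normSq_apply,
      Complex.mul_re _ (w * χ k)]
    ring
  simp only [hsq, Finset.sum_add_distrib, ← Finset.mul_sum, sum_re_mul_addChar hχ, Finset.sum_const,
    Finset.card_univ, nsmul_eq_mul]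
  ring

theorem sum_charEnergy_shift_sub_sq (hχ : χ ^ 2 ≠ 1) (q k : G) :
    ∑ j, ((charEnergy χ (j + q) - charEnergy χ (k + q)) - (charEnergy χ j - charEnergy χ k)) ^ 2 =
      2 * Fintype.card G * ‖χ q - 1‖ ^ 2 +
        4 * Fintype.card G * ((χ q - 1) * χ k).re ^ 2 := by
  have hχ1 : χ ≠ 1 := fun h => hχ (by rw [h, one_pow])
  have hsub : ∀ j,
      ((charEnergy χ (j + q) - charEnergy χ (k + q)) - (charEnergy χ j - charEnergy χ k)) ^ 2 =
        4 * ((χ q - 1) * χ j).re ^ 2 + 4 * ((χ q - 1) * χ k).re ^ 2 -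
          8 * ((χ q - 1) * χ k).re * ((χ q - 1) * χ j).re := by
    intro j
    rw [sub_sub_sub_comm, charEnergy_add_sub, charEnergy_add_sub]
    ring
  simp only [hsub, Finset.sum_sub_distrib, Finset.sum_add_distrib, ← Finset.mul_sum,
    sum_re_mul_addChar hχ1, sum_re_mul_addChar_sq hχ, Finset.sum_const,
    Finset.card_univ, nsmul_eq_mul]
  ring

theorem le_sum_charEnergy_shift_sub_sq (hχ : χ ^ 2 ≠ 1) (q k : G) :
    2 * Fintype.card G * ‖χ q - 1‖ ^ 2 ≤ ∑ j,
      ((charEnergy χ (j + q) - charEnergy χ (k + q)) - (charEnergy χ j - charEnergy χ k)) ^ 2 := by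
  rw [sum_charEnergy_shift_sub_sq hχ]
  exact le_add_of_nonneg_right (by positivity)

theorem sum_charEnergy_shift_sub_sq_le (hχ : χ ^ 2 ≠ 1) (q k : G) :
    ∑ j, ((charEnergy χ (j + q) - charEnergy χ (k + q)) - (charEnergy χ j - charEnergy χ k)) ^ 2 ≤
      6 * Fintype.card G * ‖χ q - 1‖ ^ 2 := by
  have hre : ((χ q - 1) * χ k).re ^ 2 ≤ ‖χ q - 1‖ ^ 2 := by
    refine sq_le_sq.2 ?_
    rw [abs_norm]
    simpa [AddChar.norm_apply] using Complex.abs_re_le_norm ((χ q - 1) * χ k)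
  calc _ = 2 * Fintype.card G * ‖χ q - 1‖ ^ 2 + 4 * Fintype.card G * ((χ q - 1) * χ k).re ^ 2 :=
        sum_charEnergy_shift_sub_sq hχ q k
    _ ≤ 2 * Fintype.card G * ‖χ q - 1‖ ^ 2 + 4 * Fintype.card G * ‖χ q - 1‖ ^ 2 := by gcongr
    _ = 6 * Fintype.card G * ‖χ q - 1‖ ^ 2 := by ring

theorem norm_pow_sub_one_le {z : ℂ} (hz : ‖z‖ = 1) (i : ℕ) : ‖z ^ i - 1‖ ≤ i * ‖z - 1‖ := by
  rw [← geom_sum_mul, norm_mul]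
  gcongr
  exact (norm_sum_le _ _).trans (by simp [hz])

theorem inv_card_le_norm_addChar_sub_one {q : G} (hq : χ q ≠ 1) :
    (Fintype.card G : ℝ)⁻¹ ≤ ‖χ q - 1‖ := by
  set n := Fintype.card G
  have hn : (0 : ℝ) < n := Nat.cast_pos.2 Fintype.card_pos
  have hpow : χ q ^ n = 1 := by
    rw [← AddChar.map_nsmul_eq_pow, card_nsmul_eq_zero, AddChar.map_zero_eq_one]
  have hgeom : ∑ i ∈ Finset.range n, χ q ^ i = 0 := by
    rw [geom_sum_eq hq, hpow, sub_self, zero_div]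
  have hle : (n : ℝ) ≤ n * (n * ‖χ q - 1‖) :=
    calc (n : ℝ) = ‖∑ i ∈ Finset.range n, (χ q ^ i - 1)‖ := by
          simp [Finset.sum_sub_distrib, hgeom]
      _ ≤ ∑ _ ∈ Finset.range n, n * ‖χ q - 1‖ := by
          refine norm_sum_le_of_le _ fun i hi =>
            (norm_pow_sub_one_le (AddChar.norm_apply χ q) i).trans ?_
          have := (Finset.mem_range.1 hi).le
          gcongr
      _ = n * (n * ‖χ q - 1‖) := by simp
  rw [inv_le_iff_one_le_mul₀' hn]
  exact le_of_mul_le_mul_left (by rwa [mul_one]) hn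

end CharEnergy

/-! ### The Fourier transform -/

section FourierMatrix

variable {R : Type*} [CommRing R] [Fintype R]

/-- The matrix `F j k = |R|^{-1/2} ψ(j k)` of the Fourier transform on the finite ring `R`, with
respect to an additive character `ψ`. -/
noncomputable def fourierMatrix (ψ : AddChar R ℂ) : Matrix R R ℂ :=
  Matrix.of fun j k => ((1 / √(Fintype.card R) : ℝ) : ℂ) * ψ (j * k)

theorem star_fourierMatrix_mul_fourierMatrix (ψ : AddChar R ℂ) (j k l : R) :
    star (fourierMatrix ψ j k) * fourierMatrix ψ j l =
      (Fintype.card R : ℂ)⁻¹ * ψ (j * (l - k)) := by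
  have hnorm : ((1 / √(Fintype.card R) : ℝ) : ℂ) * ((1 / √(Fintype.card R) : ℝ) : ℂ) =
      (Fintype.card R : ℂ)⁻¹ := by
    rw [← Complex.ofReal_mul, one_div, ← mul_inv, Real.mul_self_sqrt (Nat.cast_nonneg _),
      Complex.ofReal_inv, Complex.ofReal_natCast]
  rw [fourierMatrix, Matrix.of_apply, Matrix.of_apply, star_mul', RCLike.star_def,
    Complex.conj_ofReal, mul_mul_mul_comm, hnorm, ← AddChar.map_neg_eq_conj,
    ← AddChar.map_add_eq_mul, mul_sub, neg_add_eq_sub]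

variable [DecidableEq R] {ψ : AddChar R ℂ}

theorem fourierMatrix_mem_unitary (hψ : ψ.IsPrimitive) :
    fourierMatrix ψ ∈ unitary (Matrix R R ℂ) := by
  refine Matrix.mem_unitaryGroup_iff'.2 (Matrix.ext fun k l => ?_)
  simp only [Matrix.star_eq_conjTranspose, Matrix.mul_apply, Matrix.conjTranspose_apply,
    star_fourierMatrix_mul_fourierMatrix, ← Finset.mul_sum, AddChar.sum_mulShift _ hψ,
    sub_eq_zero, Matrix.one_apply, eq_comm (a := l)]
  split_ifs <;> simp

/-- Conjugation `X ↦ F X F†` by the Fourier matrix, which turns operators that are diagonal in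
momentum space into translation invariant ones. -/
noncomputable def fourierConj (hψ : ψ.IsPrimitive) : Matrix R R ℂ ≃⋆ₐ[ℂ] Matrix R R ℂ :=
  Unitary.conjStarAlgAut ℂ _ ⟨fourierMatrix ψ, fourierMatrix_mem_unitary hψ⟩

theorem fourierConj_eq_of_mul_fourierMatrix_eq (hψ : ψ.IsPrimitive) {D H : Matrix R R ℂ}
    (h : H * fourierMatrix ψ = fourierMatrix ψ * D) : fourierConj hψ D = H := by
  rw [fourierConj, Unitary.conjStarAlgAut_apply, ← h, mul_assoc,
    Unitary.mul_star_self_of_mem (fourierMatrix_mem_unitary hψ), mul_one]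

theorem fourierConj_symm_single (hψ : ψ.IsPrimitive) (s : ℂ) (a k l : R) :
    (fourierConj hψ).symm (s • Matrix.single a a 1) k l =
      s * ((Fintype.card R : ℂ)⁻¹ * ψ (a * (l - k))) := by
  rw [map_smul, Matrix.smul_apply, smul_eq_mul, ← star_fourierMatrix_mul_fourierMatrix,
    fourierConj, Unitary.conjStarAlgAut_symm_apply, Matrix.mul_apply,
    Finset.sum_eq_single_of_mem a (Finset.mem_univ a) fun b _ hb => by
      rw [Matrix.mul_single_apply_of_ne _ _ _ _ _ hb, zero_mul],
    Matrix.mul_single_apply_same, mul_one, Matrix.star_apply]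

theorem correlation_fourierConj_symm_single (hψ : ψ.IsPrimitive) (s : ℝ) (p q : R × R) :
    correlation (fun a => (fourierConj hψ).symm ((s : ℂ) • Matrix.single a a 1)) p q =
      if p.1 - p.2 = q.1 - q.2 then ((s ^ 2 / Fintype.card R : ℝ) : ℂ) else 0 := by
  have hchar : ∀ a, ψ (a * (p.2 - p.1)) * star (ψ (a * (q.2 - q.1))) =
      ψ (a * ((q.1 - q.2) - (p.1 - p.2))) := fun a => by
    rw [RCLike.star_def, ← AddChar.map_neg_eq_conj, ← AddChar.map_add_eq_mul]
    congr 1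
    ring
  have hterm : ∀ a, s * ((Fintype.card R : ℂ)⁻¹ * ψ (a * (p.2 - p.1))) *
      star (s * ((Fintype.card R : ℂ)⁻¹ * ψ (a * (q.2 - q.1)))) =
        s ^ 2 * ((Fintype.card R : ℂ)⁻¹) ^ 2 * ψ (a * ((q.1 - q.2) - (p.1 - p.2))) := fun a => by
    rw [← hchar, star_mul', star_mul', RCLike.star_def, Complex.conj_ofReal, map_inv₀,
      Complex.conj_natCast]
    ring
  simp only [correlation, fourierConj_symm_single, hterm, ← Finset.mul_sum,
    AddChar.sum_mulShift _ hψ, sub_eq_zero, eq_comm (a := q.1 - q.2)]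
  split_ifs
  · have hcard : (Fintype.card R : ℂ) ≠ 0 := Nat.cast_ne_zero.2 Fintype.card_ne_zero
    push_cast
    field_simp
  · simp

theorem lindbladian_fourierConj_symm_apply {β σ : ℝ} (hβ : 0 ≤ β) (hσ : 0 < σ)
    (hψ : ψ.IsPrimitive) (E : R → ℝ) (s : ℝ) (X : Matrix R R ℂ) :
    lindbladian β σ (diagonalHamiltonian E)
        (fun a => (fourierConj hψ).symm ((s : ℂ) • Matrix.single a a 1)) X =
      kossakowskiDissipator
        (covariantKernel (fun a b => s ^ 2 / Fintype.card R * theta β σ a b) E) X := by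
  rw [lindbladian_diagonalHamiltonian_apply hβ hσ]
  · congr 1
    ext p q
    rw [correlation_fourierConj_symm_single, covariantKernel, mul_ite, mul_zero, mul_comm,
      Complex.ofReal_mul]
  · intro k l l' hl
    rw [correlation_fourierConj_symm_single, if_neg (sub_right_injective.ne hl)]

theorem spectralGap_lindbladian_fourierConj {β σ : ℝ} (hβ : 0 ≤ β) (hσ : 0 < σ)
    (hψ : ψ.IsPrimitive) (E : R → ℝ) (A : R → Matrix R R ℂ) :
    spectralGap (lindbladian β σ (fourierConj hψ (diagonalHamiltonian E)) A) =
      spectralGap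
        (lindbladian β σ (diagonalHamiltonian E) fun a => (fourierConj hψ).symm (A a)) := by
  symm
  rw [← spectralGap_conj (fourierConj hψ).toAlgEquiv.toLinearEquiv,
    ← lindbladian_starAlgEquiv hβ hσ]
  simp only [StarAlgEquiv.apply_symm_apply]

end FourierMatrix

section InjectiveCharacter

variable {R : Type*} [CommRing R] {ψ : AddChar R ℂ}

theorem addChar_apply_ne_one (hψ : Function.Injective ψ) {q : R} (hq : q ≠ 0) : ψ q ≠ 1 := by
  rw [← AddChar.map_zero_eq_one ψ]
  exact hψ.ne hq

theorem isPrimitive_of_injective (hψ : Function.Injective ψ) : ψ.IsPrimitive := fun a ha h =>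
  addChar_apply_ne_one hψ ha (by simpa using DFunLike.congr_fun h 1)

theorem sq_ne_one_of_injective (hψ : Function.Injective ψ) (h2 : (2 : R) ≠ 0) : ψ ^ 2 ≠ 1 := by
  intro h
  refine addChar_apply_ne_one hψ h2 ?_
  rw [← one_add_one_eq_two, AddChar.map_add_eq_mul, ← sq, ← AddChar.pow_apply, h, AddChar.one_apply]

variable [Fintype R] [DecidableEq R]

/-- The Lindbladian, in momentum space, of the Cayley graph of `R` with steps `±1` and jumps
`|R|^{-1/2} |e_a⟩⟨e_a|`. -/
noncomputable def momentumLindbladian (β σ : ℝ) (hψ : ψ.IsPrimitive) :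
    Module.End ℂ (Matrix R R ℂ) :=
  lindbladian β σ (diagonalHamiltonian (charEnergy ψ)) fun a =>
    (fourierConj hψ).symm (((1 / √(Fintype.card R) : ℝ) : ℂ) • Matrix.single a a 1)

theorem momentumLindbladian_apply {β σ : ℝ} (hβ : 0 ≤ β) (hσ : 0 < σ) (hψ : ψ.IsPrimitive)
    (X : Matrix R R ℂ) : momentumLindbladian β σ hψ X = kossakowskiDissipator
      (covariantKernel (fun a b => ((Fintype.card R : ℝ) ^ 2)⁻¹ * theta β σ a b)
        (charEnergy ψ)) X := by
  have hs : (1 / √(Fintype.card R)) ^ 2 / (Fintype.card R : ℝ) = ((Fintype.card R : ℝ) ^ 2)⁻¹ := by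
    rw [div_pow, one_pow, Real.sq_sqrt (Nat.cast_nonneg _), sq, mul_inv, one_div, div_eq_mul_inv]
  rw [momentumLindbladian, lindbladian_fourierConj_symm_apply hβ hσ, hs]

theorem le_spectralGap_momentumLindbladian {β σ c : ℝ} (hβ : 0 ≤ β) (hσ : 0 < σ) (hc : 0 ≤ c)
    (hθ : ∀ ν, |ν| ≤ 4 → c ≤ theta β σ ν ν)
    (hdefect : ∀ a b, |a| ≤ 4 → |b| ≤ 4 → c * (a - b) ^ 2 ≤ defect (theta β σ) a b)
    (hψ : Function.Injective ψ) (h2 : (2 : R) ≠ 0) :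
    c * ((Fintype.card R : ℝ) ^ 3)⁻¹ ≤
      spectralGap (momentumLindbladian β σ (isPrimitive_of_injective hψ)) := by
  have : Nontrivial R := ⟨2, 0, h2⟩
  set n : ℝ := (Fintype.card R : ℝ)
  have hn : 1 ≤ n := Nat.one_le_cast.2 Fintype.card_pos
  refine le_trans (le_min ?_ ?_) <| le_spectralGap_of_covariantKernel (c := (n ^ 2)⁻¹ * c)
    (δ := (n ^ 2)⁻¹ * (c * (2 * n * n⁻¹ ^ 2)))
    (momentumLindbladian_apply hβ hσ (isPrimitive_of_injective hψ)) ?_ ?_ ?_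
  · calc c * (n ^ 3)⁻¹ ≤ c * n⁻¹ := by
          gcongr
          exact le_self_pow₀ hn (by norm_num)
      _ = n * ((n ^ 2)⁻¹ * c) := by field_simp
  · refine le_of_eq ?_
    field_simp
  · exact fun a b => mul_nonneg (by positivity) (theta_nonneg hσ a b)
  · exact fun i k => mul_le_mul_of_nonneg_left (hθ _ (abs_charEnergy_sub_le ψ i k)) (by positivity)
  · intro q hq k
    simp only [defect_const_mul, ← Finset.mul_sum]
    gcongr
    calc c * (2 * n * n⁻¹ ^ 2) ≤ c * (2 * n * ‖ψ q - 1‖ ^ 2) := by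
          gcongr
          exact inv_card_le_norm_addChar_sub_one (addChar_apply_ne_one hψ hq)
      _ ≤ c * ∑ j, ((charEnergy ψ (j + q) - charEnergy ψ (k + q)) -
            (charEnergy ψ j - charEnergy ψ k)) ^ 2 := by
          gcongr
          exact le_sum_charEnergy_shift_sub_sq (sq_ne_one_of_injective hψ h2) q k
      _ ≤ _ := by
          rw [Finset.mul_sum]
          exact Finset.sum_le_sum fun j _ =>
            hdefect _ _ (abs_charEnergy_sub_le ψ _ _) (abs_charEnergy_sub_le ψ _ _)

theorem spectralGap_momentumLindbladian_le {β σ r : ℝ} (hβ : 0 ≤ β) (hσ : 0 < σ)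
    (hψ : Function.Injective ψ) (h2 : (2 : R) ≠ 0)
    (hr : ‖ψ 1 - 1‖ ≤ r * (Fintype.card R : ℝ)⁻¹) :
    spectralGap (momentumLindbladian β σ (isPrimitive_of_injective hψ)) ≤
      3 * r ^ 2 / (4 * σ ^ 2) * ((Fintype.card R : ℝ) ^ 3)⁻¹ := by
  have : Nontrivial R := ⟨2, 0, h2⟩
  set n : ℝ := (Fintype.card R : ℝ)
  have hn : 0 < n := Nat.cast_pos.2 Fintype.card_pos
  refine (spectralGap_le_of_covariantKernel (q := 1) (β := β)
    (δ := (n ^ 2)⁻¹ * (1 / (4 * σ ^ 2) * (6 * n * (r * n⁻¹) ^ 2)))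
    (momentumLindbladian_apply hβ hσ (isPrimitive_of_injective hψ))
    ?_ ?_ one_ne_zero ?_ ?_).trans_eq ?_
  · exact fun a b => mul_nonneg (by positivity) (theta_nonneg hσ a b)
  · intro a b
    rw [defect_const_mul]
    exact mul_nonneg (by positivity) (defect_theta_nonneg hβ hσ a b)
  · intro a b
    rw [theta_neg_neg hσ, mul_left_comm]
  · intro k
    simp only [defect_const_mul, ← Finset.mul_sum]
    gcongr
    calc _ ≤ 1 / (4 * σ ^ 2) * ∑ j, ((charEnergy ψ (j + 1) - charEnergy ψ (k + 1)) -
            (charEnergy ψ j - charEnergy ψ k)) ^ 2 := by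
          rw [Finset.mul_sum]
          exact Finset.sum_le_sum fun j _ => defect_theta_le hβ hσ _ _
      _ ≤ 1 / (4 * σ ^ 2) * (6 * n * ‖ψ 1 - 1‖ ^ 2) := by
          gcongr
          exact sum_charEnergy_shift_sub_sq_le (sq_ne_one_of_injective hψ h2) 1 k
      _ ≤ 1 / (4 * σ ^ 2) * (6 * n * (r * n⁻¹) ^ 2) := by gcongr
  · field_simp
    ring

end InjectiveCharacter

/-! ### The cycle -/

section Cycle

open scoped Fin.CommRing

/-- The character `j ↦ exp(2πi j / n)` of the vertices of the cycle of length `n = m + 3`. -/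
noncomputable def cycleChar (m : ℕ) : AddChar (Fin (m + 3)) ℂ :=
  ZMod.stdAddChar.compAddMonoidHom (ZMod.finEquiv (m + 3) : Fin (m + 3) →+ ZMod (m + 3))

variable (m : ℕ)

theorem cycleChar_injective : Function.Injective (cycleChar m) :=
  ZMod.injective_stdAddChar.comp (ZMod.finEquiv (m + 3)).injective

theorem norm_cycleChar_one_sub_one_le :
    ‖cycleChar m 1 - 1‖ ≤ 2 * Real.pi * ((m + 3 : ℕ) : ℝ)⁻¹ := by
  have hexp : cycleChar m 1 =
      Complex.exp (Complex.I * ((2 * Real.pi * ((m + 3 : ℕ) : ℝ)⁻¹ : ℝ) : ℂ)) := by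
    rw [cycleChar, AddChar.compAddMonoidHom_apply]
    refine (congrArg _ (map_one (ZMod.finEquiv (m + 3)))).trans ?_
    rw [← Int.cast_one, ZMod.stdAddChar_coe]
    push_cast
    ring_nf
  rw [hexp]
  exact Real.norm_exp_I_mul_ofReal_sub_one_le.trans_eq (Real.norm_of_nonneg (by positivity))

theorem two_ne_zero_fin : (2 : Fin (m + 3)) ≠ 0 := by
  simp [Fin.ext_iff, Nat.mod_eq_of_lt]

theorem cycleHamiltonian_mul_fourierMatrix (ψ : AddChar (Fin (m + 3)) ℂ) :
    cycleHamiltonian (m + 3) * fourierMatrix ψ =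
      fourierMatrix ψ * diagonalHamiltonian (charEnergy ψ) := by
  ext j k
  have hne : j - 1 ≠ j + 1 := fun h => two_ne_zero_fin m (by linear_combination -h)
  have hnbr : (SimpleGraph.cycleGraph (m + 3)).neighborFinset j = {j - 1, j + 1} := by
    convert SimpleGraph.cycleGraph_neighborFinset (n := m + 1) (v := j)
  rw [cycleHamiltonian, SimpleGraph.adjMatrix_mul_apply, hnbr, Finset.sum_pair hne,
    diagonalHamiltonian, Matrix.mul_diagonal]
  simp only [fourierMatrix, Matrix.of_apply, charEnergy]
  rw [sub_one_mul, add_one_mul, sub_eq_add_neg, AddChar.map_add_eq_mul, AddChar.map_add_eq_mul,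
    AddChar.map_neg_eq_conj, ← Complex.add_conj]
  ring

theorem spectralGap_lindbladian_cycle {β σ : ℝ} (hβ : 0 ≤ β) (hσ : 0 < σ)
    {ψ : AddChar (Fin (m + 3)) ℂ} (hψ : ψ.IsPrimitive) :
    spectralGap (lindbladian β σ (cycleHamiltonian (m + 3)) (localJump (m + 3))) =
      spectralGap (momentumLindbladian β σ hψ) := by
  rw [← fourierConj_eq_of_mul_fourierMatrix_eq hψ (cycleHamiltonian_mul_fourierMatrix m ψ),
    spectralGap_lindbladian_fourierConj hβ hσ, momentumLindbladian, Fintype.card_fin]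
  rfl

theorem exists_le_spectralGap_cycle {β σ : ℝ} (hβ : 0 ≤ β) (hσ : 0 < σ) :
    ∃ c, 0 < c ∧ ∀ m : ℕ, c * (((m + 3 : ℕ) : ℝ) ^ 3)⁻¹ ≤
      spectralGap (lindbladian β σ (cycleHamiltonian (m + 3)) (localJump (m + 3))) := by
  obtain ⟨c, hc, hθ⟩ := exists_le_theta_self hβ hσ 4
  obtain ⟨d, hd, hdefect⟩ := exists_le_defect_theta hβ hσ 4
  refine ⟨min c d, lt_min hc hd, fun m => ?_⟩
  rw [spectralGap_lindbladian_cycle m hβ hσ (isPrimitive_of_injective (cycleChar_injective m))]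
  refine (congrArg _ (by rw [Fintype.card_fin])).trans_le <|
    le_spectralGap_momentumLindbladian hβ hσ (lt_min hc hd).le
    (fun ν hν => (min_le_left c d).trans (hθ ν hν)) (fun a b ha hb => ?_)
    (cycleChar_injective m) (two_ne_zero_fin m)
  exact (mul_le_mul_of_nonneg_right (min_le_right c d) (sq_nonneg _)).trans (hdefect a b ha hb)

theorem spectralGap_cycle_le {β σ : ℝ} (hβ : 0 ≤ β) (hσ : 0 < σ) :
    spectralGap (lindbladian β σ (cycleHamiltonian (m + 3)) (localJump (m + 3))) ≤
      3 * Real.pi ^ 2 / σ ^ 2 * (((m + 3 : ℕ) : ℝ) ^ 3)⁻¹ := by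
  rw [spectralGap_lindbladian_cycle m hβ hσ (isPrimitive_of_injective (cycleChar_injective m))]
  refine (spectralGap_momentumLindbladian_le (r := 2 * Real.pi) hβ hσ (cycleChar_injective m)
    (two_ne_zero_fin m) ?_).trans_eq ?_
  · rw [Fintype.card_fin]
    exact norm_cycleChar_one_sub_one_le m
  · rw [Fintype.card_fin]
    ring

end Cycle

end CKG

theorem theorem1_general (β σ : ℝ) (hβ : 0 ≤ β) (hσ : 0 < σ) :
    (fun n : ℕ =>
      CKG.spectralGap (CKG.lindbladian β σ (CKG.cycleHamiltonian n) (CKG.localJump n)))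
      =Θ[atTop] (fun n : ℕ => ((n : ℝ) ^ 3)⁻¹) := by
  obtain ⟨c, hc, hlower⟩ := CKG.exists_le_spectralGap_cycle hβ hσ
  have hnorm (n : ℕ) : ‖((n : ℝ) ^ 3)⁻¹‖ = ((n : ℝ) ^ 3)⁻¹ := Real.norm_of_nonneg (by positivity)
  have hgap {m : ℕ} := Real.norm_of_nonneg
    ((mul_nonneg hc.le (by positivity : 0 ≤ (((m + 3 : ℕ) : ℝ) ^ 3)⁻¹)).trans (hlower m))
  refine ⟨IsBigO.of_bound (3 * Real.pi ^ 2 / σ ^ 2) ?_, IsBigO.of_bound c⁻¹ ?_⟩ <;>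
    filter_upwards [eventually_ge_atTop 3] with n hn <;>
    obtain ⟨m, rfl⟩ := Nat.exists_eq_add_of_le' hn <;>
    rw [hnorm, hgap]
  · exact CKG.spectralGap_cycle_le m hβ hσ
  · exact (le_inv_mul_iff₀ hc).2 (hlower m)

theorem theorem1 (β : ℝ) (hβ : 0 < β) :
    ∃ σ : ℝ, 0 < σ ∧
      (fun n : ℕ => CKG.spectralGap (CKG.lindbladian β σ (CKG.cycleHamiltonian n) (CKG.localJump n)))
        =Θ[atTop] (fun n : ℕ => ((n : ℝ) ^ 3)⁻¹) :=
  ⟨1, one_pos, theorem1_general β 1 hβ.le one_pos⟩
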